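/- A strict partition is a finite strictly decreasing sequence of positive integers $\lambda=(\lambda_1>\lambda_2>\cdots>\lambda_\ell>0)$; its size is $|\lambda|=\sum_i\lambda_i$, its length is $\ell(\lambda)=\ell$, and $\lambda_i=0$ for $i>\ell$. Its shifted Young diagram consists of the boxes $(i,j)$ (row $i$, column $j$) with $1\le i\le \ell$ and $i+1\le j\le i+\lambda_i$. The content of the box $\square=(i,j)$ is $c_\square=j-i$. Its hook length is the number of boxes strictly to its right in the same row, plus the number of boxes strictly below it in the same column, plus $1$, plus $\lambda_j$. Let $H_\lambda$ be the product of the hook lengths of all boxes of $\lambda$, and let $f_\lambda$ be the number of standard shifted Young tableaux of shape $\lambda$, that is, of bijective labellings of the boxes by $1,\dots,|\lambda|$ that increase along rows and down columns. Theorem. For all integers $k\ge 0$ and $n\ge 0$, $$\sum_{|\lambda|=n}\frac{2^{|\lambda|-\ell(\lambda)}f_\lambda}{H_\lambda}\sum_{\square\in\lambda}\binom{c_\square+k-1}{2k}=\frac{2^k}{(k+1)!}\binom{n}{k+1},$$ where the outer sum is over all strict partitions $\lambda$ of size $n$. Moreover (the identity corresponding to the case $k=0$), for every $n\ge 0$,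 $$\sum_{|\lambda|=n}2^{\,n-\ell(\lambda)}f_\lambda^2=n!.$$ -/

import Mathlib

/-- A strict partition: a finite strictly decreasing sequence of positive integers. -/
@[ext] structure StrictPartition where
  parts : List ℕ
  sorted : parts.SortedGT
  pos : ∀ x ∈ parts, 0 < x

namespace StrictPartition

/-- The size: the sum of the parts. -/
def size (p : StrictPartition) : ℕ := p.parts.sum

/-- The length: the number of parts. -/
def length (p : StrictPartition) : ℕ := p.parts.length

/-- The `i`-th part, for `i = 1, 2, 3, …`; it is `0` when `i` exceeds the length. -/
def part (p : StrictPartition) (i : ℕ) : ℕ := p.parts.getD (i - 1) 0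

/-- The shifted Young diagram, as a set of boxes (row, column) in matrix coordinates: for
`1 ≤ i ≤ length`, row `i` consists of the boxes `(i, i + 1), …, (i, i + part i)`. -/
def cells (p : StrictPartition) : Finset (ℕ × ℕ) :=
  (Finset.Icc 1 p.length).biUnion fun i =>
    (Finset.Icc (i + 1) (i + p.part i)).image fun j => (i, j)

theorem mem_cells (p : StrictPartition) (i j : ℕ) :
    (i, j) ∈ p.cells ↔ (1 ≤ i ∧ i ≤ p.length) ∧ (i < j ∧ j ≤ i + p.part i) := by
  simp only [cells, Finset.mem_biUnion, Finset.mem_image, Finset.mem_Icc, Prod.mk.injEq]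
  constructor
  · rintro ⟨a, ha, b, hb, rfl, rfl⟩
    exact ⟨ha, by omega, hb.2⟩
  · rintro ⟨hi, hj⟩
    exact ⟨i, hi, j, ⟨by omega, hj.2⟩, rfl, rfl⟩

/-- The content `j - i` of the box `(i, j)`. Every box of a shifted diagram has `i < j`, so the
subtraction of natural numbers is the ordinary one. -/
def content (b : ℕ × ℕ) : ℕ := b.2 - b.1

/-- The hook length of the box `(i, j)`: the number of boxes strictly to the right in the same
row, plus the number of boxes strictly below in the same column, plus one for the box itself,
plus the `j`-th part of the partition. -/
def hookLength (p : StrictPartition) (b : ℕ × ℕ) : ℕ :=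
  (p.cells.filter fun c => c.1 = b.1 ∧ b.2 < c.2).card +
    (p.cells.filter fun c => c.2 = b.2 ∧ b.1 < c.1).card + 1 + p.part b.2

/-- The product of the hook lengths of all boxes. -/
def hookProduct (p : StrictPartition) : ℕ := ∏ b ∈ p.cells, p.hookLength b

/-- A standard shifted Young tableau of shape `p`: a bijective labelling of the boxes by
`0, …, size - 1` (in place of `1, …, size`) whose labels increase strictly from left to right
along each row and from top to bottom along each column. -/
structure StandardTableau (p : StrictPartition) where
  label : p.cells ≃ Fin p.size
  row_lt : ∀ a b : p.cells, a.1.1 = b.1.1 → a.1.2 < b.1.2 → label a < label b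
  col_lt : ∀ a b : p.cells, a.1.2 = b.1.2 → a.1.1 < b.1.1 → label a < label b

theorem StandardTableau.label_injective (p : StrictPartition) :
    Function.Injective (StandardTableau.label (p := p)) := by
  rintro ⟨a, _, _⟩ ⟨b, _, _⟩ h
  cases h
  rfl

instance (p : StrictPartition) : Finite (StandardTableau p) :=
  Finite.of_injective _ (StandardTableau.label_injective p)

/-- The number of standard shifted Young tableaux of shape `p`. -/
noncomputable def numTableaux (p : StrictPartition) : ℕ := Nat.card (StandardTableau p)

theorem length_le_size (p : StrictPartition) : p.length ≤ p.size :=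
  List.length_le_sum_of_one_le _ p.pos

theorem finite_setOf_size_eq (n : ℕ) : {p : StrictPartition | p.size = n}.Finite := by
  refine Set.Finite.of_finite_image (f := fun p => p.parts.toFinset)
    ((Finset.finite_toSet (Finset.range (n + 1)).powerset).subset ?_) ?_
  · rintro _ ⟨p, hp, rfl⟩
    simp only [Finset.coe_powerset, Set.mem_preimage, Set.mem_powerset_iff, Finset.coe_subset]
    intro x hx
    have h := List.le_sum_of_mem (List.mem_toFinset.1 hx)
    have hp' : p.parts.sum = n := hp
    exact Finset.mem_range.2 (by omega)
  · intro p _ q _ h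
    have hperm : p.parts.Perm q.parts :=
      List.perm_of_nodup_nodup_toFinset_eq p.sorted.nodup q.sorted.nodup h
    exact StrictPartition.ext (hperm.eq_of_pairwise' p.sorted.pairwise q.sorted.pairwise)

/-- The finite set of all strict partitions of size `n`. -/
noncomputable def ofSize (n : ℕ) : Finset StrictPartition :=
  (finite_setOf_size_eq n).toFinset

theorem mem_ofSize (n : ℕ) (p : StrictPartition) : p ∈ ofSize n ↔ p.size = n := by
  simp [ofSize]

end StrictPartition

/-! Encode a strict partition by its finite set `S` of parts. Its hook product is the explicit
product `hookWeight S` (`hookProduct_eq_hookWeight`), and peeling off the largest label gives `f =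
n! / H` (`numTableaux_eq`, which rests on `sum_hookWeight_div`). Both sums therefore become
expectations under the weights `2 ^ (n - ℓ) * n! / H ^ 2`, and the second identity says that the
total mass is one.

These weights form a coherent family: level `n + 1` is obtained from level `n` by adding one box
with transition weights `upWeight` (`average_succ`). The weights are the residues of the rational
function with zeros at the nodes `b (b - 1)`, for `b` in `S`, and poles at `b (b + 1)`, for `b` in
`S` or `b = 0`. Hence their moments are the coefficients of `∏ (1 - y t) / (1 - x t)`, which are
polynomials in the supersymmetric power sums, and these in turn are content sums of polynomials in
`c (c - 1)`.

Give the sum over boxes of `(c (c - 1)) ^ r` degree `r + 1`. A box added to a row of length `a` has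
content `a + 1` and changes this sum by the `r`-th power of the node `a (a + 1)`; averaging that
power gives the `r`-th moment, of degree at most `r`. So the difference in `n` of an average is the
average of a function of lower degree (`DegreeLT.fwdDiff_average`), and an average of degree `k + 1`
is a polynomial in `n` of degree at most `k + 1`.

The binomial content sum has degree at most `k + 1`. Its average vanishes for `n ≤ k`, because all
contents are too small, and at `n = k + 1` only the one-row shape contributes. Newton's expansion
then leaves a single binomial coefficient. -/

namespace StrictPartition

/-! ### Nodes, the product formula for hooks, and removal of a box -/

/-- The node `a (a + 1)`. -/
def upNode (a : ℕ) : ℚ := a * (a + 1)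

/-- The node `a (a - 1)`. -/
def downNode (a : ℕ) : ℚ := a * (a - 1)

theorem downNode_succ (a : ℕ) : downNode (a + 1) = upNode a := by
  simp only [downNode, upNode]; push_cast; ring

theorem upNode_injective : Function.Injective upNode := by
  intro a b h
  simp only [upNode] at h
  have h' : a * (a + 1) = b * (b + 1) := by exact_mod_cast h
  rcases lt_trichotomy a b with hab | hab | hab
  · nlinarith
  · exact hab
  · nlinarith

theorem downNode_injOn {S : Finset ℕ} (hS : 0 ∉ S) : Set.InjOn downNode S := by
  intro a ha b hb h
  have ha0 : a ≠ 0 := fun h0 => hS (h0 ▸ ha)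
  have hb0 : b ≠ 0 := fun h0 => hS (h0 ▸ hb)
  obtain ⟨a, rfl⟩ := Nat.exists_eq_succ_of_ne_zero ha0
  obtain ⟨b, rfl⟩ := Nat.exists_eq_succ_of_ne_zero hb0
  rw [Nat.succ_eq_add_one, Nat.succ_eq_add_one, downNode_succ, downNode_succ] at h
  rw [upNode_injective h]

/-- The product formula for the product of the hook lengths, in terms of the set of parts. -/
def hookWeight (S : Finset ℕ) : ℚ :=
  ∏ a ∈ S, ((a.factorial : ℚ) * ∏ b ∈ S with b < a, ((a : ℚ) + b) / (a - b))

/-- The absolute value merges the pairs in which `c` is the larger part with those in which it is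
the smaller. -/
theorem hookWeight_insert {c : ℕ} {S : Finset ℕ} (hc : c ∉ S) :
    hookWeight (insert c S) =
      c.factorial * hookWeight S * ∏ b ∈ S, ((c : ℚ) + b) / |(c : ℚ) - b| := by
  have key : ∀ a ∈ S, (∏ b ∈ insert c S with b < a, ((a : ℚ) + b) / (a - b)) =
      (if c < a then ((a : ℚ) + c) / (a - c) else 1) *
        ∏ b ∈ S with b < a, ((a : ℚ) + b) / (a - b) := by
    intro a _
    rw [Finset.filter_insert]
    split_ifs with h
    · rw [Finset.prod_insert (by simp [hc])]
    · rw [one_mul]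
  have hsplit : ∏ b ∈ S, ((c : ℚ) + b) / |(c : ℚ) - b| =
      (∏ b ∈ S with b < c, ((c : ℚ) + b) / (c - b)) *
        ∏ a ∈ S, (if c < a then ((a : ℚ) + c) / (a - c) else 1) := by
    rw [Finset.prod_filter, ← Finset.prod_mul_distrib]
    refine Finset.prod_congr rfl fun b hb => ?_
    rcases lt_trichotomy b c with h | h | h
    · have h' : (b : ℚ) < c := by exact_mod_cast h
      rw [if_pos h, if_neg (by omega), mul_one, abs_of_pos (by linarith)]
    · exact absurd (h ▸ hb) hc
    · have h' : (c : ℚ) < b := by exact_mod_cast h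
      rw [if_neg (by omega), if_pos h, one_mul, abs_of_neg (by linarith), neg_sub, add_comm]
  rw [hookWeight, Finset.prod_insert hc, Finset.filter_insert, if_neg (lt_irrefl c), hsplit,
    Finset.prod_mul_distrib, Finset.prod_congr rfl key, Finset.prod_mul_distrib, hookWeight,
    Finset.prod_mul_distrib]
  ring

theorem hookWeight_pos (S : Finset ℕ) : 0 < hookWeight S := by
  refine Finset.prod_pos fun a _ => mul_pos (by exact_mod_cast a.factorial_pos)
    (Finset.prod_pos fun b hb => ?_)
  have h : (b : ℚ) < a := by exact_mod_cast (Finset.mem_filter.1 hb).2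
  have h0 : (0 : ℚ) ≤ b := b.cast_nonneg
  exact div_pos (by linarith) (by linarith)

theorem hookWeight_insert_zero (S : Finset ℕ) : hookWeight (insert 0 S) = hookWeight S := by
  by_cases h : 0 ∈ S
  · rw [Finset.insert_eq_of_mem h]
  · rw [hookWeight_insert h, Finset.prod_eq_one]
    · simp
    · intro b hb
      have : (b : ℚ) ≠ 0 := by
        rintro h0
        exact h (by rwa [Nat.cast_eq_zero.1 h0] at hb)
      simp [this]

theorem hookWeight_erase_zero (S : Finset ℕ) : hookWeight (S.erase 0) = hookWeight S := by
  by_cases h : 0 ∈ S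
  · rw [← hookWeight_insert_zero, Finset.insert_erase h]
  · rw [Finset.erase_eq_of_notMem h]

theorem upNode_sub_upNode (a b : ℕ) : upNode a - upNode b = ((a : ℚ) - b) * (a + b + 1) := by
  simp only [upNode]; ring

theorem upNode_sub_downNode (a b : ℕ) : upNode a - downNode b = ((a : ℚ) + b) * (a + 1 - b) := by
  simp only [upNode, downNode]; ring

/-- The ratio of hook weights across one edge of the graph of strict partitions, in terms of nodes.
It holds factor by factor: no `b` in `S` is `c` or `c + 1`, so `c - b` and `c + 1 - b` have the same
sign and the absolute values cancel consistently. -/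
theorem hookWeight_insert_succ {c : ℕ} {S : Finset ℕ} (hc : c ∉ S) (hc' : c + 1 ∉ S) :
    hookWeight (insert c S) * ((c + 1) * ∏ b ∈ S, (upNode c - upNode b)) =
      hookWeight (insert (c + 1) S) * ∏ b ∈ S, (upNode c - downNode b) := by
  have key : ∏ b ∈ S, (((c : ℚ) + b) / |(c : ℚ) - b| * (upNode c - upNode b)) =
      ∏ b ∈ S, ((((c + 1 : ℕ) : ℚ) + b) / |((c + 1 : ℕ) : ℚ) - b| * (upNode c - downNode b)) := by
    refine Finset.prod_congr rfl fun b hb => ?_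
    rw [upNode_sub_upNode, upNode_sub_downNode]
    push_cast
    rcases lt_trichotomy b c with h | h | h
    · have h' : (b : ℚ) < c := by exact_mod_cast h
      rw [abs_of_pos (by linarith), abs_of_pos (by linarith)]
      have h1 : (c : ℚ) - b ≠ 0 := by linarith
      have h2 : (c : ℚ) + 1 - b ≠ 0 := by linarith
      field_simp
      ring
    · exact absurd (h ▸ hb) hc
    · have h' : (c : ℚ) + 1 < b := by
        have : c + 1 < b := lt_of_le_of_ne h fun h0 => hc' (h0 ▸ hb)
        exact_mod_cast this
      rw [abs_of_neg (by linarith), abs_of_neg (by linarith)]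
      have h1 : (c : ℚ) - b ≠ 0 := by linarith
      have h2 : (c : ℚ) + 1 - b ≠ 0 := by linarith
      field_simp
      ring
  rw [Finset.prod_mul_distrib, Finset.prod_mul_distrib] at key
  rw [hookWeight_insert hc, hookWeight_insert hc', Nat.factorial_succ]
  push_cast at key ⊢
  linear_combination ((c.factorial : ℚ) * hookWeight S * (c + 1)) * key

/-- The hook product is multiplicative along removal of a box, with total weight the size. -/
theorem sum_hookWeight_div (S : Finset ℕ) (hS : 0 ∉ S) :
    ∑ c ∈ S with c - 1 ∉ S, hookWeight S / hookWeight (insert (c - 1) (S.erase c)) =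
      ((∑ c ∈ S, c : ℕ) : ℚ) := by
  classical
  rcases S.eq_empty_or_nonempty with rfl | hne
  · simp
  have hcard : 0 < S.card := hne.card_pos
  set N : Polynomial ℚ := ∏ b ∈ S, (Polynomial.X - Polynomial.C (upNode b)) with hN
  set D : Polynomial ℚ := ∏ b ∈ S, (Polynomial.X - Polynomial.C (downNode b)) with hD
  have hNm : N.Monic := Polynomial.monic_prod_of_monic _ _ fun _ _ => Polynomial.monic_X_sub_C _
  have hDm : D.Monic := Polynomial.monic_prod_of_monic _ _ fun _ _ => Polynomial.monic_X_sub_C _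
  have hNd : N.degree = S.card := by
    rw [hN, Polynomial.degree_prod]; simp
  have hDd : D.degree = S.card := by
    rw [hD, Polynomial.degree_prod]; simp
  have hdeg : (N - D).degree < S.card := by
    rw [← hNd]
    exact Polynomial.degree_sub_lt_left (hNd.trans hDd.symm) hNm.ne_zero
      (hNm.leadingCoeff.trans hDm.leadingCoeff.symm)
  -- Interpolate `N - D` at the zeros of `D` and compare the coefficients of `X ^ (S.card - 1)`: one
  -- side is a difference of sums of nodes, the other a sum over the parts.
  have key := Lagrange.coeff_eq_sum (downNode_injOn hS) hdeg
  rw [Polynomial.coeff_sub, hN, hD, Polynomial.prod_X_sub_C_coeff_card_pred _ _ hcard,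
    Polynomial.prod_X_sub_C_coeff_card_pred _ _ hcard] at key
  have hsum : ∑ c ∈ S, upNode c - ∑ c ∈ S, downNode c = 2 * ((∑ c ∈ S, c : ℕ) : ℚ) := by
    push_cast
    rw [← Finset.sum_sub_distrib, Finset.mul_sum]
    exact Finset.sum_congr rfl fun c _ => by simp only [upNode, downNode]; ring
  have hterm : ∀ c ∈ S, (Polynomial.eval (downNode c) (N - D)) /
      ∏ j ∈ S.erase c, (downNode c - downNode j) =
      -2 * (if c - 1 ∉ S then hookWeight S / hookWeight (insert (c - 1) (S.erase c)) else 0) := by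
    intro c hc
    obtain ⟨d, rfl⟩ := Nat.exists_eq_succ_of_ne_zero (fun h0 => hS (h0 ▸ hc) : c ≠ 0)
    have hDz : Polynomial.eval (downNode d.succ) D = 0 := by
      rw [hD, Polynomial.eval_prod]
      exact Finset.prod_eq_zero hc (by simp)
    rw [Polynomial.eval_sub, hDz, sub_zero, hN, Polynomial.eval_prod]
    simp only [Polynomial.eval_sub, Polynomial.eval_X, Polynomial.eval_C, Nat.succ_eq_add_one,
      Nat.add_sub_cancel, downNode_succ]
    by_cases h : d ∉ S
    · rw [if_pos h]
      have hcd : d + 1 ∉ S.erase (d + 1) := Finset.notMem_erase _ _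
      have hd : d ∉ S.erase (d + 1) := fun h0 => h (Finset.mem_of_mem_erase h0)
      have hW := hookWeight_insert_succ hd hcd
      rw [Finset.insert_erase hc] at hW
      have hW0 := (hookWeight_pos (insert d (S.erase (d + 1)))).ne'
      have hP : ∏ j ∈ S.erase (d + 1), (upNode d - downNode j) ≠ 0 := by
        refine Finset.prod_ne_zero_iff.2 fun j hj h0 => (Finset.ne_of_mem_erase hj) ?_
        rw [← downNode_succ] at h0
        exact (downNode_injOn hS (Finset.mem_of_mem_erase hj) hc (sub_eq_zero.1 h0).symm)
      -- The factor of `N` at the part `d + 1` itself is `-2 (d + 1)`; this is the source of the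
      -- constant `-2`.
      rw [← Finset.mul_prod_erase S _ hc, upNode_sub_upNode, div_eq_iff hP]
      push_cast
      rw [← mul_div_assoc, div_mul_eq_mul_div, eq_div_iff hW0]
      linear_combination (-2 : ℚ) * hW
    -- A row that cannot be shortened drops out by itself: the down node of `d + 1` is the up node
    -- of `d`, a zero of `N`.
    · have h' : d ∈ S := not_not.1 h
      rw [Finset.prod_eq_zero h' (sub_self _), if_neg h]
      simp
  rw [Finset.sum_congr rfl hterm, ← Finset.mul_sum, ← Finset.sum_filter] at key
  linarith

/-! ### Transition weights; the row of length `0` stands for a new row -/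

/-- The transition weight of adding a box to the row of length `a`. -/
def upWeight (S : Finset ℕ) (a : ℕ) : ℚ :=
  (∏ b ∈ S, (upNode a - downNode b)) / ∏ b ∈ (insert 0 S).erase a, (upNode a - upNode b)

theorem upWeight_eq_zero {S : Finset ℕ} {a : ℕ} (h : a + 1 ∈ S) : upWeight S a = 0 := by
  rw [upWeight, Finset.prod_eq_zero h (by rw [downNode_succ, sub_self]), zero_div]

theorem prod_erase_ne_zero (S : Finset ℕ) (a : ℕ) :
    ∏ b ∈ S.erase a, (upNode a - upNode b) ≠ 0 :=
  Finset.prod_ne_zero_iff.2 fun _ hj h0 =>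
    (Finset.ne_of_mem_erase hj) (upNode_injective (sub_eq_zero.1 h0).symm)

theorem upWeight_zero {S : Finset ℕ} (hS : 0 ∉ S) (h : 1 ∉ S) :
    upWeight S 0 = hookWeight S / hookWeight (insert 1 S) := by
  have hW := hookWeight_insert_succ hS h
  have hP := prod_erase_ne_zero (insert 0 S) 0
  rw [Finset.erase_insert hS] at hP
  rw [upWeight, Finset.erase_insert hS, div_eq_div_iff hP (hookWeight_pos _).ne']
  rw [hookWeight_insert_zero] at hW
  simp only [zero_add, Nat.cast_zero, one_mul] at hW
  linarith

/-- The numerator factor at `b = a` is `2 a` and the denominator factor at `b = 0` is `a (a + 1)`.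
The resulting `2` matches the growth of `2 ^ (n - ℓ)` when an existing row is lengthened. -/
theorem upWeight_of_mem {S : Finset ℕ} (hS : 0 ∉ S) {a : ℕ} (ha : a ∈ S) (h : a + 1 ∉ S) :
    upWeight S a = 2 * (hookWeight S / hookWeight (insert (a + 1) (S.erase a))) := by
  have hW := hookWeight_insert_succ (Finset.notMem_erase a S)
    (fun h0 => h (Finset.mem_of_mem_erase h0))
  rw [Finset.insert_erase ha] at hW
  have ha0 : a ≠ 0 := fun h0 => hS (h0 ▸ ha)
  have ha0' : (a : ℚ) ≠ 0 := by exact_mod_cast ha0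
  have hP := prod_erase_ne_zero (insert 0 S) a
  rw [← mul_div_assoc, upWeight, div_eq_div_iff hP (hookWeight_pos _).ne']
  rw [Finset.erase_insert_of_ne (Ne.symm ha0),
    Finset.prod_insert (fun h0 => hS (Finset.mem_of_mem_erase h0)),
    ← Finset.mul_prod_erase S _ ha, upNode_sub_downNode, upNode_sub_upNode]
  push_cast
  linear_combination (-2 * (a : ℚ)) * hW

/-! ### Moments of the transition weights by partial fractions -/

section Moments

open PowerSeries

/-- The geometric series `1 / (1 - v t)`. -/
noncomputable def geomSeries (v : ℚ) : PowerSeries ℚ := PowerSeries.mk fun n => v ^ n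

theorem one_sub_mul_geomSeries (v : ℚ) : (1 - C v * X) * geomSeries v = 1 := by
  ext n
  cases n with
  | zero => simp [geomSeries]
  | succ n =>
    simp [geomSeries, sub_mul, mul_assoc, coeff_succ_X_mul, coeff_one, pow_succ']

theorem derivative_geomSeries (v : ℚ) :
    d⁄dX ℚ (geomSeries v) = geomSeries v * (C v * geomSeries v) := by
  have h := congrArg (d⁄dX ℚ) (one_sub_mul_geomSeries v)
  rw [Derivation.leibniz] at h
  simp only [smul_eq_mul, map_sub, Derivation.leibniz, derivative_one, derivative_X, derivative_C]
    at h
  have h1 := one_sub_mul_geomSeries v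
  linear_combination geomSeries v * h - (d⁄dX ℚ (geomSeries v)) * h1

/-- The generating series of the moments of the transition weights. -/
noncomputable def momentSeries (S : Finset ℕ) : PowerSeries ℚ :=
  ∏ b ∈ S, ((1 - C (downNode b) * X) * geomSeries (upNode b))

theorem derivative_momentSeries (S : Finset ℕ) :
    d⁄dX ℚ (momentSeries S) = momentSeries S *
      ∑ b ∈ S, (C (upNode b) * geomSeries (upNode b) -
        C (downNode b) * geomSeries (downNode b)) := by
  classical
  induction S using Finset.induction_on with
  | empty => simp [momentSeries]
  | insert b S hb ih =>
    rw [momentSeries, Finset.prod_insert hb, Finset.sum_insert hb, ← momentSeries,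
      Derivation.leibniz, Derivation.leibniz, ih, derivative_geomSeries]
    simp only [smul_eq_mul, map_sub, Derivation.leibniz, derivative_one, derivative_X,
      derivative_C]
    have h1 := one_sub_mul_geomSeries (downNode b)
    linear_combination
      (momentSeries S * C (downNode b) * geomSeries (upNode b)) * h1

/-- The moments of the transition weights. -/
noncomputable def moment (m : ℕ) (S : Finset ℕ) : ℚ := coeff m (momentSeries S)

/-- The supersymmetric power sums. -/
noncomputable def powerSum (r : ℕ) (S : Finset ℕ) : ℚ :=
  ∑ b ∈ S, (upNode b ^ r - downNode b ^ r)

theorem moment_zero (S : Finset ℕ) : moment 0 S = 1 := by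
  simp [moment, momentSeries, geomSeries, map_prod]

/-- Newton's identity between complete and power sums, read off from the logarithmic derivative of
the generating series. -/
theorem succ_mul_moment (m : ℕ) (S : Finset ℕ) :
    ((m : ℚ) + 1) * moment (m + 1) S =
      ∑ ij ∈ Finset.HasAntidiagonal.antidiagonal m, moment ij.1 S * powerSum (ij.2 + 1) S := by
  have h := congrArg (coeff m) (derivative_momentSeries S)
  rw [coeff_derivative, coeff_mul] at h
  rw [moment, mul_comm, h]
  refine Finset.sum_congr rfl fun ij _ => ?_
  rw [moment, powerSum, map_sum]
  congr 1
  refine Finset.sum_congr rfl fun b _ => ?_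
  simp [geomSeries, pow_succ']

/-- Partial fractions with denominators cleared: Lagrange interpolation evaluated at `1 / x` and
multiplied by `x ^ t.card`. -/
theorem sum_prod_one_sub_mul_X {ι : Type*} [DecidableEq ι] {s : Finset ι} {v : ι → ℚ}
    (hv : Set.InjOn v s) {N : Polynomial ℚ} {κ : Type*} {t : Finset κ} {u : κ → ℚ}
    (hN : N = ∏ b ∈ t, (Polynomial.X - Polynomial.C (u b))) (hc : s.card = t.card + 1) :
    ∑ i ∈ s, Polynomial.C (N.eval (v i) / ∏ j ∈ s.erase i, (v i - v j)) *
      ∏ j ∈ s.erase i, (1 - Polynomial.C (v j) * Polynomial.X) =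
      ∏ b ∈ t, (1 - Polynomial.C (u b) * Polynomial.X) := by
  have hdeg : N.degree < s.card := by
    rw [hN, hc, Polynomial.degree_prod]
    simp only [Polynomial.degree_X_sub_C, Finset.sum_const, nsmul_eq_mul, mul_one]
    exact_mod_cast Nat.lt_succ_self _
  have hL := Lagrange.eq_interpolate hv hdeg
  refine Polynomial.eq_of_infinite_eval_eq _ _
    (Set.Infinite.mono (s := {0}ᶜ) (fun x hx => ?_) (Set.finite_singleton (0 : ℚ)).infinite_compl)
  have hx0 : x ≠ 0 := hx
  have hsub : ∀ w : ℚ, 1 - w * x = x * (x⁻¹ - w) := fun w => by field_simp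
  have hE := congrArg (Polynomial.eval x⁻¹) hL
  rw [Lagrange.interpolate_apply, Polynomial.eval_finsetSum] at hE
  simp only [Set.mem_ofPred_eq, Polynomial.eval_finsetSum, Polynomial.eval_mul,
    Polynomial.eval_prod, Polynomial.eval_sub, Polynomial.eval_one, Polynomial.eval_C,
    Polynomial.eval_X, hsub, Finset.prod_mul_distrib, Finset.prod_const]
  have hNx : N.eval x⁻¹ = ∏ b ∈ t, (x⁻¹ - u b) := by
    rw [hN, Polynomial.eval_prod]; simp
  rw [← hNx, hE, Finset.mul_sum]
  refine Finset.sum_congr rfl fun i hi => ?_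
  rw [Finset.card_erase_of_mem hi, hc, Nat.add_sub_cancel, Polynomial.eval_mul,
    Polynomial.eval_C, Lagrange.basis, Polynomial.eval_prod]
  have hb : ∏ j ∈ s.erase i, Polynomial.eval x⁻¹ (Lagrange.basisDivisor (v i) (v j)) =
      (∏ j ∈ s.erase i, (v i - v j))⁻¹ * ∏ j ∈ s.erase i, (x⁻¹ - v j) := by
    rw [← Finset.prod_inv_distrib, ← Finset.prod_mul_distrib]
    simp [Lagrange.basisDivisor]
  rw [hb]
  ring

theorem sum_upWeight_mul_geomSeries {S : Finset ℕ} (hS : 0 ∉ S) :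
    ∑ a ∈ insert 0 S, C (upWeight S a) * geomSeries (upNode a) = momentSeries S := by
  have h := sum_prod_one_sub_mul_X (s := insert 0 S) (v := upNode) upNode_injective.injOn
    (t := S) (u := downNode) rfl (Finset.card_insert_of_notMem hS)
  have h' := congrArg (Polynomial.coeToPowerSeries.ringHom (R := ℚ)) h
  simp only [map_sum, map_mul, map_prod, map_sub, map_one,
    Polynomial.coeToPowerSeries.ringHom_apply, Polynomial.coe_C, Polynomial.coe_X] at h'
  have hU : ∏ j ∈ insert 0 S, ((1 - C (upNode j) * X) * geomSeries (upNode j)) = 1 :=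
    Finset.prod_eq_one fun j _ => one_sub_mul_geomSeries _
  -- The extra pole is at the node `0`, so it contributes nothing to the product.
  have hg0 : geomSeries (upNode 0) = 1 := by
    have := one_sub_mul_geomSeries (upNode 0)
    simpa [upNode] using this
  have hM : momentSeries S = (∏ b ∈ S, (1 - C (downNode b) * X)) *
      ∏ j ∈ insert 0 S, geomSeries (upNode j) := by
    rw [momentSeries, Finset.prod_mul_distrib, Finset.prod_insert hS, hg0, one_mul]
  rw [hM, ← h', Finset.sum_mul]
  refine Finset.sum_congr rfl fun a ha => ?_
  have hw : Polynomial.eval (upNode a) (∏ b ∈ S, (Polynomial.X - Polynomial.C (downNode b))) /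
      ∏ j ∈ (insert 0 S).erase a, (upNode a - upNode j) = upWeight S a := by
    rw [upWeight, Polynomial.eval_prod]; simp
  rw [hw, mul_assoc]
  congr 1
  rw [← Finset.mul_prod_erase (insert 0 S) (fun j => geomSeries (upNode j)) ha, mul_left_comm,
    ← Finset.prod_mul_distrib, Finset.prod_eq_one fun j _ => one_sub_mul_geomSeries _, mul_one]

theorem sum_upWeight_mul_pow {S : Finset ℕ} (hS : 0 ∉ S) (m : ℕ) :
    ∑ a ∈ insert 0 S, upWeight S a * upNode a ^ m = moment m S := by
  rw [moment, ← sum_upWeight_mul_geomSeries hS, map_sum]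
  exact Finset.sum_congr rfl fun a _ => by simp [geomSeries]

end Moments

/-! ### Content sums and the degree filtration -/

/-- The sum over all boxes of a function of the content. -/
def contentSum (φ : ℕ → ℚ) (S : Finset ℕ) : ℚ := ∑ a ∈ S, ∑ c ∈ Finset.Icc 1 a, φ c

/-- The sum over all boxes of the `r`-th power of `c (c - 1)`, where `c` is the content. -/
def contentPowerSum (r : ℕ) : Finset ℕ → ℚ := contentSum fun c => downNode c ^ r

/-- The filtration of the algebra generated by the content power sums in which
`contentPowerSum r` has degree `r + 1`: elements of degree less than `d`. -/
inductive DegreeLT : ℕ → (Finset ℕ → ℚ) → Prop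
  | zero (d : ℕ) : DegreeLT d 0
  | const (d : ℕ) (c : ℚ) : DegreeLT (d + 1) fun _ => c
  | add {d : ℕ} {F G : Finset ℕ → ℚ} : DegreeLT d F → DegreeLT d G → DegreeLT d (F + G)
  | mul (r : ℕ) {d : ℕ} {F : Finset ℕ → ℚ} : DegreeLT d F →
      DegreeLT (d + r + 1) (contentPowerSum r * F)
  | mono {d e : ℕ} {F : Finset ℕ → ℚ} : DegreeLT d F → d ≤ e → DegreeLT e F

namespace DegreeLT

theorem mul_of_lt {d : ℕ} {F : Finset ℕ → ℚ} (hF : DegreeLT d F) :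
    ∀ {e : ℕ} {G : Finset ℕ → ℚ}, DegreeLT (e + 1) G → DegreeLT (d + e) (F * G) := by
  have hconst : ∀ (c : ℚ) {e : ℕ} {G : Finset ℕ → ℚ}, DegreeLT e G →
      DegreeLT e ((fun _ => c) * G) := by
    intro c e G hG
    induction hG with
    | zero d => rw [mul_zero]; exact .zero d
    | const d c' => exact .const d (c * c')
    | add _ _ h1 h2 => rw [mul_add]; exact h1.add h2
    | mul r _ h => rw [mul_left_comm]; exact h.mul r
    | mono _ hle h => exact h.mono hle
  induction hF with
  | zero d => intro e G _; rw [zero_mul]; exact .zero _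
  | const d c => intro e G hG; exact (hconst c hG).mono (by omega)
  | add _ _ h1 h2 => intro e G hG; rw [add_mul]; exact (h1 hG).add (h2 hG)
  | mul r _ h =>
    intro e G hG
    rw [mul_assoc]
    exact ((h hG).mul r).mono (by omega)
  | mono _ hle h => intro e G hG; exact (h hG).mono (by omega)

theorem const_mul (c : ℚ) {d : ℕ} {F : Finset ℕ → ℚ} (hF : DegreeLT d F) :
    DegreeLT d (fun S => c * F S) := by
  rcases d with _ | d
  · have h := hF.mul_of_lt (DegreeLT.const 0 c)
    rw [mul_comm] at h
    exact h
  · exact ((DegreeLT.const 0 c).mul_of_lt hF).mono (by omega)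

theorem sum {ι : Type*} (s : Finset ι) {d : ℕ} {F : ι → Finset ℕ → ℚ}
    (h : ∀ i ∈ s, DegreeLT d (F i)) : DegreeLT d (∑ i ∈ s, F i) := by
  classical
  induction s using Finset.induction_on with
  | empty => exact .zero d
  | insert i s hi ih =>
    rw [Finset.sum_insert hi]
    exact (h i (Finset.mem_insert_self _ _)).add
      (ih fun j hj => h j (Finset.mem_insert_of_mem hj))

theorem contentPowerSum_mem (r : ℕ) : DegreeLT (r + 2) (contentPowerSum r) := by
  have h := (DegreeLT.const 0 1).mul r
  exact (mul_one (contentPowerSum r) ▸ h).mono (by omega)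

theorem contentSum_eval (q : Polynomial ℚ) {d : ℕ} (hq : q.degree < d) :
    DegreeLT (d + 1) (contentSum fun c => q.eval (downNode c)) := by
  have hsum : (contentSum fun c => q.eval (downNode c)) =
      ∑ r ∈ Finset.range d, fun S => q.coeff r * contentPowerSum r S := by
    funext S
    rw [Finset.sum_apply]
    simp only [contentSum, contentPowerSum, Finset.mul_sum]
    rw [Finset.sum_comm]
    refine Finset.sum_congr rfl fun a _ => ?_
    rw [Finset.sum_comm]
    refine Finset.sum_congr rfl fun c _ => ?_
    rcases eq_or_ne q 0 with rfl | h0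
    · simp
    · exact Polynomial.eval_eq_sum_range' ((Polynomial.natDegree_lt_iff_degree_lt h0).2 hq) _
  rw [hsum]
  refine DegreeLT.sum _ fun r hr => ((contentPowerSum_mem r).const_mul _).mono ?_
  have := Finset.mem_range.1 hr
  omega

end DegreeLT

/-- Since `downNode (c + 1) = upNode c`, the left side is a second difference of `c ↦ upNode c ^ r`.
With `y = c (c + 1)`, the neighbouring nodes have sum `2 y + 2` and product `y ^ 2 - 2 y`, so their
power sums satisfy a two-term recurrence over polynomials in `y`. -/
theorem exists_polynomial_secondDifference (r : ℕ) :
    ∃ q : Polynomial ℚ, q.degree < r ∧ ∀ c : ℕ,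
      (upNode (c + 1) ^ r - downNode (c + 1) ^ r) - (upNode c ^ r - downNode c ^ r) =
        q.eval (downNode (c + 1)) := by
  induction r using Nat.twoStepInduction with
  | zero => exact ⟨0, by simp, fun c => by simp⟩
  | one => exact ⟨2, by
      rw [show (2 : Polynomial ℚ) = Polynomial.C 2 from rfl, Polynomial.degree_C two_ne_zero]
      simp, fun c => by
      simp only [upNode, downNode, show (2 : Polynomial ℚ) = Polynomial.C 2 from rfl,
        Polynomial.eval_C]
      push_cast; ring⟩
  | more r ih0 ih1 =>
    obtain ⟨q0, hd0, hq0⟩ := ih0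
    obtain ⟨q1, hd1, hq1⟩ := ih1
    -- Recurrence for the power sum of the two neighbours minus `2 y ^ r`; the subtracted terms
    -- leave `8 y ^ (r + 1)`.
    refine ⟨(Polynomial.C 2 * Polynomial.X + Polynomial.C 2) * q1 -
      (Polynomial.X ^ 2 - Polynomial.C 2 * Polynomial.X) * q0 +
        Polynomial.C 8 * Polynomial.X ^ (r + 1), ?_, fun c => ?_⟩
    · have hA : (Polynomial.C (2 : ℚ) * Polynomial.X + Polynomial.C 2).natDegree ≤ 1 := by
        compute_degree
      have hB : (Polynomial.X ^ 2 - Polynomial.C (2 : ℚ) * Polynomial.X).natDegree ≤ 2 := by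
        compute_degree
      have hC : (Polynomial.C (8 : ℚ) * Polynomial.X ^ (r + 1)).natDegree ≤ r + 1 := by
        compute_degree
      have hlt : ∀ (n : ℕ) {p : Polynomial ℚ} {m : ℕ} {q : Polynomial ℚ}, p.natDegree ≤ m →
          q.degree < n → (p * q).degree < ((m + n : ℕ) : WithBot ℕ) := by
        intro n p m q hp hq
        rcases eq_or_ne (p * q) 0 with h0 | h0
        · rw [h0, Polynomial.degree_zero]; exact WithBot.bot_lt_coe _
        · rw [← Polynomial.natDegree_lt_iff_degree_lt h0]
          have := (Polynomial.natDegree_lt_iff_degree_lt (right_ne_zero_of_mul h0)).2 hq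
          have := Polynomial.natDegree_mul_le (p := p) (q := q)
          omega
      have h1 := hlt _ hA hd1
      have h2 := hlt _ hB hd0
      have h3 : (Polynomial.C (8 : ℚ) * Polynomial.X ^ (r + 1)).degree <
          ((r + 2 : ℕ) : WithBot ℕ) :=
        lt_of_le_of_lt (Polynomial.natDegree_le_iff_degree_le.1 hC)
          (by exact_mod_cast Nat.lt_succ_self _)
      rw [show 1 + (r + 1) = r + 2 by omega] at h1
      rw [show 2 + r = r + 2 by omega] at h2
      exact lt_of_le_of_lt (Polynomial.degree_add_le _ _)
        (max_lt (lt_of_le_of_lt (Polynomial.degree_sub_le _ _) (max_lt h1 h2)) h3)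
    · have e0 := hq0 c
      have e1 := hq1 c
      simp only [Polynomial.eval_add, Polynomial.eval_sub, Polynomial.eval_mul, Polynomial.eval_C,
        Polynomial.eval_pow, Polynomial.eval_X]
      rw [← e0, ← e1]
      simp only [downNode_succ, pow_succ]
      simp only [upNode, downNode]
      push_cast
      ring

/-- Each row telescopes, starting from `upNode 0 = downNode 0 = 0`. -/
theorem powerSum_eq_contentSum {r : ℕ} {q : Polynomial ℚ}
    (hq : ∀ c : ℕ, (upNode (c + 1) ^ r - downNode (c + 1) ^ r) - (upNode c ^ r - downNode c ^ r) =
        q.eval (downNode (c + 1))) :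
    powerSum r = contentSum fun c => q.eval (downNode c) := by
  funext S
  refine Finset.sum_congr rfl fun a ha => ?_
  clear ha
  induction a with
  | zero => simp [upNode, downNode]
  | succ a ih =>
    rw [Finset.sum_Icc_succ_top (by omega), ← ih, ← hq]
    ring

theorem DegreeLT.powerSum_mem (r : ℕ) : DegreeLT (r + 1) (powerSum r) := by
  obtain ⟨q, hd, hq⟩ := exists_polynomial_secondDifference r
  rw [powerSum_eq_contentSum hq]
  exact DegreeLT.contentSum_eval q hd

/-- Strong induction through Newton's identity, the `r`-th power sum having degree at most `r`. -/
theorem DegreeLT.moment_mem (m : ℕ) : DegreeLT (m + 1) (moment m) := by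
  induction m using Nat.strong_induction_on with
  | _ m ih =>
    rcases m with _ | m
    · rw [show moment 0 = fun _ => 1 from funext moment_zero]
      exact .const 0 1
    · have h : moment (m + 1) = fun S => ((m : ℚ) + 1)⁻¹ *
          (∑ ij ∈ Finset.HasAntidiagonal.antidiagonal m,
            moment ij.1 * powerSum (ij.2 + 1)) S := by
        funext S
        have hm : (m : ℚ) + 1 ≠ 0 := by positivity
        rw [eq_inv_mul_iff_mul_eq₀ hm, succ_mul_moment, Finset.sum_apply]
        rfl
      rw [h]
      refine DegreeLT.const_mul _ (DegreeLT.sum _ fun ij hij => ?_)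
      have hij' := Finset.HasAntidiagonal.mem_antidiagonal.1 hij
      exact ((ih ij.1 (by omega)).mul_of_lt (DegreeLT.powerSum_mem (ij.2 + 1))).mono (by omega)

/-! ### The effect of adding a box, and its average -/

/-- Polynomials in an extra variable over the filtered algebra, with total degree less than
`d - 1`. -/
inductive IncrementLT : ℕ → (Finset ℕ → ℚ → ℚ) → Prop
  | zero (d : ℕ) : IncrementLT d 0
  | term (m : ℕ) {d : ℕ} {G : Finset ℕ → ℚ} : DegreeLT d G →
      IncrementLT (d + m + 1) fun S x => x ^ m * G S
  | add {d : ℕ} {R T : Finset ℕ → ℚ → ℚ} : IncrementLT d R → IncrementLT d T →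
      IncrementLT d (R + T)
  | mono {d e : ℕ} {R : Finset ℕ → ℚ → ℚ} : IncrementLT d R → d ≤ e → IncrementLT e R

theorem IncrementLT.contentPowerSum_mul (r : ℕ) {d : ℕ} {R : Finset ℕ → ℚ → ℚ}
    (hR : IncrementLT d R) :
    IncrementLT (d + r + 1) fun S x => contentPowerSum r S * R S x := by
  induction hR with
  | zero d =>
    simp only [Pi.zero_apply, mul_zero]
    exact .zero _
  | term m hG =>
    simp only [mul_left_comm (contentPowerSum r _)]
    exact (IncrementLT.term m (hG.mul r)).mono (by omega)
  | add _ _ h1 h2 =>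
    simp only [Pi.add_apply, mul_add]
    exact h1.add h2
  | mono _ hle h => exact h.mono (by omega)

theorem IncrementLT.pow_mul (r : ℕ) {d : ℕ} {R : Finset ℕ → ℚ → ℚ}
    (hR : IncrementLT d R) : IncrementLT (d + r) fun S x => x ^ r * R S x := by
  induction hR with
  | zero d =>
    simp only [Pi.zero_apply, mul_zero]
    exact .zero _
  | term m hG =>
    simp only [← mul_assoc, ← pow_add]
    exact (IncrementLT.term (r + m) hG).mono (by omega)
  | add _ _ h1 h2 =>
    simp only [Pi.add_apply, mul_add]
    exact h1.add h2
  | mono _ hle h => exact h.mono (by omega)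

theorem contentSum_insert_succ (φ : ℕ → ℚ) {S : Finset ℕ} {a : ℕ} (ha : a ∈ insert 0 S)
    (h : a + 1 ∉ S) :
    contentSum φ (insert (a + 1) (S.erase a)) = contentSum φ S + φ (a + 1) := by
  have h' : a + 1 ∉ S.erase a := fun h0 => h (Finset.mem_of_mem_erase h0)
  have hS : contentSum φ S = ∑ c ∈ Finset.Icc 1 a, φ c + contentSum φ (S.erase a) := by
    by_cases haS : a ∈ S
    · exact (Finset.add_sum_erase S _ haS).symm
    · obtain rfl : a = 0 := by simpa [haS] using ha
      rw [Finset.erase_eq_of_notMem haS]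
      simp
  rw [hS, contentSum, Finset.sum_insert h', Finset.sum_Icc_succ_top (by omega), contentSum]
  ring

/-- A content power sum of degree `r + 1` changes by `x ^ r`, of degree `r`, where `x` is the node
of the lengthened row. Expanding a product of such sums therefore loses at least one degree. -/
theorem DegreeLT.exists_increment {d : ℕ} {F : Finset ℕ → ℚ} (hF : DegreeLT d F) :
    ∃ R, IncrementLT d R ∧ ∀ (S : Finset ℕ) (a : ℕ), a ∈ insert 0 S → a + 1 ∉ S →
      F (insert (a + 1) (S.erase a)) = F S + R S (upNode a) := by
  induction hF with
  | zero d => exact ⟨0, .zero d, fun _ _ _ _ => by simp⟩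
  | const d c => exact ⟨0, .zero _, fun _ _ _ _ => by simp⟩
  | add _ _ h1 h2 =>
    obtain ⟨R, hR, eR⟩ := h1
    obtain ⟨T, hT, eT⟩ := h2
    refine ⟨R + T, hR.add hT, fun S a ha h => ?_⟩
    simp only [Pi.add_apply, eR S a ha h, eT S a ha h]
    ring
  | @mul r d F hF h1 =>
    obtain ⟨R, hR, eR⟩ := h1
    refine ⟨_, ((hR.contentPowerSum_mul r).add
      (((IncrementLT.term r hF).add ((hR.pow_mul r).mono (by omega))))), fun S a ha h => ?_⟩
    simp only [Pi.mul_apply, Pi.add_apply, eR S a ha h]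
    rw [contentPowerSum, contentSum_insert_succ _ ha h, downNode_succ]
    ring
  | mono _ hle h =>
    obtain ⟨R, hR, eR⟩ := h
    exact ⟨R, hR.mono hle, eR⟩

/-- Averaging replaces `x ^ m` by the `m`-th moment, whose degree is at most `m`, so no degree is
gained. -/
theorem IncrementLT.exists_degreeLT {d : ℕ} {R : Finset ℕ → ℚ → ℚ} (hR : IncrementLT d R) :
    ∃ G, DegreeLT (d - 1) G ∧ ∀ S : Finset ℕ, 0 ∉ S →
      ∑ a ∈ insert 0 S, upWeight S a * R S (upNode a) = G S := by
  induction hR with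
  | zero d => exact ⟨0, .zero _, fun S _ => by simp⟩
  | @term m d G hG =>
    refine ⟨G * moment m, (hG.mul_of_lt (DegreeLT.moment_mem m)).mono (by omega), fun S hS => ?_⟩
    rw [Pi.mul_apply, ← sum_upWeight_mul_pow hS, Finset.mul_sum]
    exact Finset.sum_congr rfl fun a _ => by ring
  | add _ _ h1 h2 =>
    obtain ⟨G, hG, eG⟩ := h1
    obtain ⟨H, hH, eH⟩ := h2
    refine ⟨G + H, hG.add hH, fun S hS => ?_⟩
    rw [show (G + H) S = G S + H S from rfl, ← eG S hS, ← eH S hS, ← Finset.sum_add_distrib]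
    exact Finset.sum_congr rfl fun a _ => by simp only [Pi.add_apply]; ring
  | mono _ hle h =>
    obtain ⟨G, hG, eG⟩ := h
    exact ⟨G, hG.mono (by omega), eG⟩

/-! ### The shifted Plancherel measure and its averages -/

/-- The sets of positive integers with sum `n`. -/
def partSets (n : ℕ) : Finset (Finset ℕ) :=
  (Finset.Icc 1 n).powerset.filter fun S => ∑ a ∈ S, a = n

theorem mem_partSets {n : ℕ} {S : Finset ℕ} : S ∈ partSets n ↔ 0 ∉ S ∧ ∑ a ∈ S, a = n := by
  simp only [partSets, Finset.mem_filter, Finset.mem_powerset]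
  refine ⟨fun ⟨h, hs⟩ => ⟨fun h0 => by simpa using h h0, hs⟩, fun ⟨h, hs⟩ => ⟨fun a ha => ?_, hs⟩⟩
  refine Finset.mem_Icc.2 ⟨Nat.one_le_iff_ne_zero.2 fun h0 => h (h0 ▸ ha), ?_⟩
  rw [← hs]
  exact Finset.single_le_sum (f := fun a => a) (fun _ _ => Nat.zero_le _) ha

theorem card_le_of_mem_partSets {n : ℕ} {S : Finset ℕ} (hS : S ∈ partSets n) : S.card ≤ n := by
  obtain ⟨h0, hs⟩ := mem_partSets.1 hS
  rw [← hs, Finset.card_eq_sum_ones]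
  exact Finset.sum_le_sum fun a ha => Nat.one_le_iff_ne_zero.2 fun h => h0 (h ▸ ha)

theorem sum_insert_succ_erase {S : Finset ℕ} {a : ℕ} (ha : a ∈ insert 0 S) (h : a + 1 ∉ S) :
    ∑ b ∈ insert (a + 1) (S.erase a), b = ∑ b ∈ S, b + 1 := by
  rw [Finset.sum_insert fun h0 => h (Finset.mem_of_mem_erase h0)]
  by_cases haS : a ∈ S
  · rw [← Finset.add_sum_erase S (fun b => b) haS]; ring
  · obtain rfl : a = 0 := by simpa [haS] using ha
    rw [Finset.erase_eq_of_notMem haS]; ring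

theorem insert_erase_insert_succ {S : Finset ℕ} {a : ℕ} (h : a + 1 ∉ S) :
    insert a ((insert (a + 1) (S.erase a)).erase (a + 1)) = insert a S := by
  ext x
  simp only [Finset.mem_insert, Finset.mem_erase]
  constructor
  · tauto
  · rintro (rfl | hx)
    · exact Or.inl rfl
    · have : x ≠ a + 1 := fun h0 => h (h0 ▸ hx)
      tauto

/-- Double counting of the edges between levels `n` and `n + 1`. Erasing `0` on the way down
accounts for a row of length one that disappears. -/
theorem sum_removable_eq_sum_addable (n : ℕ) (f : Finset ℕ → ℕ → ℚ) :
    ∑ S ∈ partSets (n + 1), ∑ c ∈ S with c - 1 ∉ S, f S c =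
      ∑ S ∈ partSets n, ∑ a ∈ insert 0 S with a + 1 ∉ S,
        f (insert (a + 1) (S.erase a)) (a + 1) := by
  rw [Finset.sum_sigma', Finset.sum_sigma']
  have hinv : ∀ (S : Finset ℕ) (d : ℕ), 0 ∉ S → d + 1 ∈ S → d ∉ S →
      insert (d + 1) (((insert d (S.erase (d + 1))).erase 0).erase d) = S := by
    intro S d h0 hd hd'
    ext x
    simp only [Finset.mem_insert, Finset.mem_erase]
    constructor
    · rintro (rfl | hx)
      · exact hd
      · tauto
    · intro hx
      have h1 : x ≠ 0 := fun h => h0 (h ▸ hx)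
      have h2 : x ≠ d := fun h => hd' (h ▸ hx)
      tauto
  have hdown : ∀ (S : Finset ℕ) (d : ℕ), 0 ∉ S → d + 1 ∈ S → d ∉ S →
      d ∈ insert 0 ((insert d (S.erase (d + 1))).erase 0) ∧
        d + 1 ∉ (insert d (S.erase (d + 1))).erase 0 := by
    intro S d h0 hd hd'
    simp only [Finset.mem_insert, Finset.mem_erase]
    constructor
    · tauto
    · omega
  refine Finset.sum_bij'
    (fun x _ => (⟨(insert (x.2 - 1) (x.1.erase x.2)).erase 0, x.2 - 1⟩ : (_ : Finset ℕ) × ℕ))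
    (fun x _ => (⟨insert (x.2 + 1) (x.1.erase x.2), x.2 + 1⟩ : (_ : Finset ℕ) × ℕ)) ?_ ?_ ?_ ?_ ?_
  · rintro ⟨S, c⟩ hx
    simp only [Finset.mem_sigma, mem_partSets, Finset.mem_filter] at hx ⊢
    obtain ⟨⟨h0, hs⟩, hc, hc'⟩ := hx
    obtain ⟨d, rfl⟩ := Nat.exists_eq_succ_of_ne_zero (fun h => h0 (h ▸ hc) : c ≠ 0)
    simp only [Nat.succ_eq_add_one, Nat.add_sub_cancel] at *
    obtain ⟨h1, h2⟩ := hdown S d h0 hc hc'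
    refine ⟨⟨Finset.notMem_erase _ _, ?_⟩, h1, h2⟩
    have := sum_insert_succ_erase h1 h2
    rw [hinv S d h0 hc hc'] at this
    omega
  · rintro ⟨S, a⟩ hx
    simp only [Finset.mem_sigma, mem_partSets, Finset.mem_filter] at hx ⊢
    obtain ⟨⟨h0, hs⟩, ha, ha'⟩ := hx
    refine ⟨⟨?_, by rw [sum_insert_succ_erase ha ha', hs]⟩, Finset.mem_insert_self _ _, ?_⟩
    · simp [h0]
    · simp
  · rintro ⟨S, c⟩ hx
    simp only [Finset.mem_sigma, mem_partSets, Finset.mem_filter] at hx ⊢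
    obtain ⟨⟨h0, hs⟩, hc, hc'⟩ := hx
    obtain ⟨d, rfl⟩ := Nat.exists_eq_succ_of_ne_zero (fun h => h0 (h ▸ hc) : c ≠ 0)
    simp only [Nat.succ_eq_add_one, Nat.add_sub_cancel] at *
    rw [hinv S d h0 hc hc']
  · rintro ⟨S, a⟩ hx
    simp only [Finset.mem_sigma, mem_partSets, Finset.mem_filter] at hx ⊢
    obtain ⟨⟨h0, hs⟩, ha, ha'⟩ := hx
    simp only [Nat.add_sub_cancel, insert_erase_insert_succ ha', Sigma.mk.injEq, heq_eq_eq,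
      and_true]
    ext x
    simp only [Finset.mem_insert, Finset.mem_erase] at *
    constructor
    · rintro ⟨hx0, rfl | hx⟩
      · exact ha.resolve_left hx0
      · exact hx
    · exact fun hx => ⟨fun h => h0 (h ▸ hx), Or.inr hx⟩
  · rintro ⟨S, c⟩ hx
    simp only [Finset.mem_sigma, mem_partSets, Finset.mem_filter] at hx ⊢
    obtain ⟨⟨h0, hs⟩, hc, hc'⟩ := hx
    obtain ⟨d, rfl⟩ := Nat.exists_eq_succ_of_ne_zero (fun h => h0 (h ▸ hc) : c ≠ 0)
    simp only [Nat.succ_eq_add_one, Nat.add_sub_cancel] at *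
    rw [hinv S d h0 hc hc']

/-- The shifted Plancherel measure. -/
def plancherel (n : ℕ) (S : Finset ℕ) : ℚ :=
  2 ^ (n - S.card) * n.factorial / hookWeight S ^ 2

/-- The average of a function with respect to the shifted Plancherel measure. -/
def average (F : Finset ℕ → ℚ) (n : ℕ) : ℚ := ∑ S ∈ partSets n, plancherel n S * F S

theorem plancherel_succ {n : ℕ} {S : Finset ℕ} (hS : S ∈ partSets (n + 1)) :
    plancherel (n + 1) S = ∑ c ∈ S with c - 1 ∉ S, 2 ^ (n + 1 - S.card) * n.factorial /
      (hookWeight S * hookWeight (insert (c - 1) (S.erase c))) := by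
  obtain ⟨h0, hs⟩ := mem_partSets.1 hS
  have h := sum_hookWeight_div S h0
  rw [hs] at h
  have hW := (hookWeight_pos S).ne'
  rw [plancherel, Nat.factorial_succ, Nat.cast_mul, ← h, Finset.sum_mul, Finset.mul_sum,
    Finset.sum_div]
  refine Finset.sum_congr rfl fun c _ => ?_
  have hW' := (hookWeight_pos (insert (c - 1) (S.erase c))).ne'
  field_simp

theorem plancherel_mul_upWeight {n : ℕ} {S : Finset ℕ} (hS : S ∈ partSets n) {a : ℕ}
    (ha : a ∈ insert 0 S) (h : a + 1 ∉ S) :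
    plancherel n S * upWeight S a =
      2 ^ (n + 1 - (insert (a + 1) (S.erase a)).card) * n.factorial /
        (hookWeight (insert (a + 1) (S.erase a)) * hookWeight S) := by
  obtain ⟨h0, hs⟩ := mem_partSets.1 hS
  have hW := (hookWeight_pos S).ne'
  have hW' := (hookWeight_pos (insert (a + 1) (S.erase a))).ne'
  have hcard := card_le_of_mem_partSets hS
  rw [Finset.card_insert_of_notMem fun h0 => h (Finset.mem_of_mem_erase h0)]
  by_cases haS : a ∈ S
  · rw [upWeight_of_mem h0 haS h, plancherel, Finset.card_erase_add_one haS,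
      Nat.succ_sub hcard, Nat.succ_eq_add_one, pow_succ 2]
    field_simp
  · obtain rfl : a = 0 := by simpa [haS] using ha
    rw [Finset.erase_eq_of_notMem haS] at hW' ⊢
    rw [upWeight_zero h0 h, plancherel, Nat.add_sub_add_right]
    rw [zero_add] at hW' ⊢
    field_simp

/-- Coherence of the measures: the mass at level `n + 1`, split over removable boxes, agrees edge by
edge with the mass at level `n` times the transition weight. -/
theorem average_succ (F : Finset ℕ → ℚ) (n : ℕ) :
    average F (n + 1) = ∑ S ∈ partSets n, plancherel n S *
      ∑ a ∈ insert 0 S with a + 1 ∉ S, upWeight S a * F (insert (a + 1) (S.erase a)) := by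
  have h1 : average F (n + 1) = ∑ S ∈ partSets (n + 1), ∑ c ∈ S with c - 1 ∉ S,
      2 ^ (n + 1 - S.card) * n.factorial /
        (hookWeight S * hookWeight (insert (c - 1) (S.erase c))) * F S := by
    refine Finset.sum_congr rfl fun S hS => ?_
    rw [plancherel_succ hS, Finset.sum_mul]
  rw [h1, sum_removable_eq_sum_addable n fun S c => 2 ^ (n + 1 - S.card) * n.factorial /
        (hookWeight S * hookWeight (insert (c - 1) (S.erase c))) * F S]
  refine Finset.sum_congr rfl fun S hS => ?_
  rw [Finset.mul_sum]
  refine Finset.sum_congr rfl fun a ha => ?_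
  obtain ⟨ha, ha'⟩ := Finset.mem_filter.1 ha
  rw [← mul_assoc, plancherel_mul_upWeight hS ha ha', Nat.add_sub_cancel,
    insert_erase_insert_succ ha']
  have hWa : hookWeight (insert a S) = hookWeight S := by
    rcases Finset.mem_insert.1 ha with rfl | haS
    · exact hookWeight_insert_zero S
    · rw [Finset.insert_eq_of_mem haS]
  rw [hWa]

theorem average_succ_of_increment {F : Finset ℕ → ℚ} {R : Finset ℕ → ℚ → ℚ}
    (h : ∀ (S : Finset ℕ) (a : ℕ), a ∈ insert 0 S → a + 1 ∉ S →
      F (insert (a + 1) (S.erase a)) = F S + R S (upNode a)) {G : Finset ℕ → ℚ}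
    (hG : ∀ S : Finset ℕ, 0 ∉ S → ∑ a ∈ insert 0 S, upWeight S a * R S (upNode a) = G S) (n : ℕ) :
    average F (n + 1) = average F n + average G n := by
  rw [average_succ, average, average, ← Finset.sum_add_distrib]
  refine Finset.sum_congr rfl fun S hS => ?_
  obtain ⟨h0, -⟩ := mem_partSets.1 hS
  have h1 : ∑ a ∈ insert 0 S with a + 1 ∉ S, upWeight S a * F (insert (a + 1) (S.erase a)) =
      ∑ a ∈ insert 0 S, upWeight S a * (F S + R S (upNode a)) := by
    rw [Finset.sum_filter]
    refine Finset.sum_congr rfl fun a ha => ?_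
    by_cases ha' : a + 1 ∈ S
    -- Rows that cannot be lengthened have weight zero, so the restricted sum extends to all rows
    -- and the moment formula applies.
    · rw [if_neg (not_not.2 ha'), upWeight_eq_zero ha', zero_mul]
    · rw [if_pos ha', h S a ha ha']
  have h2 := sum_upWeight_mul_pow h0 0
  simp only [pow_zero, mul_one, moment_zero] at h2
  rw [h1, ← mul_add, ← hG S h0]
  simp only [mul_add, Finset.sum_add_distrib]
  rw [← Finset.sum_mul, h2, one_mul]

theorem average_one (n : ℕ) : average (fun _ => 1) n = 1 := by
  induction n with
  | zero =>
    have : partSets 0 = {∅} := by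
      ext S
      simp only [partSets, Finset.Icc_eq_empty_of_lt one_pos, Finset.powerset_empty,
        Finset.mem_filter, Finset.mem_singleton, and_iff_left_iff_imp]
      rintro rfl
      rfl
    simp [average, this, plancherel, hookWeight]
  | succ n ih =>
    rw [average_succ_of_increment (R := 0) (G := 0) (by simp) (by simp), ih]
    simp [average]

theorem DegreeLT.eq_zero {F : Finset ℕ → ℚ} (hF : DegreeLT 0 F) : F = 0 := by
  have : ∀ {d : ℕ} {F : Finset ℕ → ℚ}, DegreeLT d F → d = 0 → F = 0 := by
    intro d F hF
    induction hF with
    | zero d => exact fun _ => rfl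
    | const d c => intro h; omega
    | add _ _ h1 h2 => intro h; rw [h1 h, h2 h, add_zero]
    | mul r _ _ => intro h; omega
    | mono _ hle h => exact fun h0 => h (by omega)
  exact this hF rfl

theorem DegreeLT.fwdDiff_average (d : ℕ) : ∀ {F : Finset ℕ → ℚ}, DegreeLT d F →
    (fwdDiff 1)^[d] (average F) = 0 := by
  induction d with
  | zero =>
    intro F hF
    rw [hF.eq_zero]
    funext n
    simp [average]
  | succ d ih =>
    intro F hF
    obtain ⟨R, hR, eR⟩ := hF.exists_increment
    obtain ⟨G, hG, eG⟩ := hR.exists_degreeLT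
    have : fwdDiff 1 (average F) = average G := by
      funext n
      rw [fwdDiff, average_succ_of_increment eR eG]
      ring
    rw [Function.iterate_succ_apply, this]
    exact ih hG

/-! ### Evaluation of the average of the binomial content sum -/

theorem eq_choose_of_fwdDiff_eq_zero {f : ℕ → ℚ} {k : ℕ} (hf : (fwdDiff 1)^[k + 2] f = 0)
    (h0 : ∀ n ≤ k, f n = 0) (n : ℕ) : f n = f (k + 1) * n.choose (k + 1) := by
  have hlow : ∀ j ≤ k, (fwdDiff 1)^[j] f 0 = 0 := by
    intro j hj
    rw [fwdDiff_iter_eq_sum_shift]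
    refine Finset.sum_eq_zero fun i hi => ?_
    have := Finset.mem_range.1 hi
    rw [h0 _ (by simp; omega), smul_zero]
  have hmid : (fwdDiff 1)^[k + 1] f 0 = f (k + 1) := by
    rw [fwdDiff_iter_eq_sum_shift, Finset.sum_range_succ, Finset.sum_eq_zero]
    · simp
    · intro i hi
      have := Finset.mem_range.1 hi
      rw [h0 _ (by simp; omega), smul_zero]
  have hhigh : ∀ j, k + 2 ≤ j → (fwdDiff 1)^[j] f 0 = 0 := by
    intro j hj
    obtain ⟨i, rfl⟩ := Nat.exists_eq_add_of_le' hj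
    rw [Function.iterate_add_apply, hf]
    have : ∀ i, (fwdDiff 1)^[i] (0 : ℕ → ℚ) = 0 := by
      intro i
      induction i with
      | zero => rfl
      | succ i ih =>
        rw [Function.iterate_succ_apply', ih]
        funext n
        simp [fwdDiff]
    rw [this]; rfl
  have h := shift_eq_sum_fwdDiff_iter 1 f n 0
  rw [zero_add, smul_eq_mul, mul_one] at h
  rw [h, Finset.sum_eq_single (k + 1), hmid, nsmul_eq_mul, mul_comm]
  · intro j _ hj
    rcases Nat.lt_or_ge j (k + 1) with h1 | h1
    · rw [hlow j (by omega), smul_zero]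
    · rw [hhigh j (by omega), smul_zero]
  · intro hk
    have : n < k + 1 := by simpa using hk
    rw [Nat.choose_eq_zero_of_lt this, zero_smul]

/-- Pair the factors of the falling factorial symmetrically: `(c + i) (c - 1 - i) = c (c - 1) - i (i
+ 1)` for `i < k`. Each step of the induction adds one such pair. -/
theorem exists_polynomial_choose (k : ℕ) : ∃ q : Polynomial ℚ, q.natDegree ≤ k ∧
    ∀ c : ℕ, 0 < c → ((c + k - 1).choose (2 * k) : ℚ) = q.eval (downNode c) := by
  induction k with
  | zero => exact ⟨1, by simp, fun c _ => by simp⟩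
  | succ k ih =>
    obtain ⟨q, hd, hq⟩ := ih
    refine ⟨Polynomial.C (((2 * k + 2) * (2 * k + 1) : ℚ)⁻¹) *
      (q * (Polynomial.X - Polynomial.C ((k : ℚ) * (k + 1)))), ?_, fun c hc => ?_⟩
    · refine (Polynomial.natDegree_C_mul_le _ _).trans (Polynomial.natDegree_mul_le.trans ?_)
      rw [Polynomial.natDegree_X_sub_C]
      omega
    · obtain ⟨c, rfl⟩ := Nat.exists_eq_succ_of_ne_zero hc.ne'
      have h := hq (c + 1) hc
      simp only [Polynomial.eval_mul, Polynomial.eval_C, Polynomial.eval_sub, Polynomial.eval_X,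
        Nat.succ_eq_add_one, ← h]
      rw [show c + 1 + (k + 1) - 1 = c + k + 1 by omega, show c + 1 + k - 1 = c + k by omega,
        show 2 * (k + 1) = 2 * k + 1 + 1 by ring]
      have e1 := Nat.add_one_mul_choose_eq (c + k) (2 * k + 1)
      have e2 := Nat.choose_succ_right_eq (c + k) (2 * k)
      have e1' : ((c : ℚ) + k + 1) * ((c + k).choose (2 * k + 1) : ℚ) =
          ((c + k + 1).choose (2 * k + 1 + 1) : ℚ) * (2 * k + 1 + 1) := by exact_mod_cast e1
      have e2' : ((c + k).choose (2 * k + 1) : ℚ) * (2 * k + 1) =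
          ((c + k).choose (2 * k) : ℚ) * (c - k) := by
        rcases Nat.lt_or_ge c k with hck | hck
        · rw [Nat.choose_eq_zero_of_lt (by omega : c + k < 2 * k),
            Nat.choose_eq_zero_of_lt (by omega : c + k < 2 * k + 1)]
          simp
        · rw [show c + k - 2 * k = c - k by omega] at e2
          have := congrArg (Nat.cast : ℕ → ℚ) e2
          push_cast [Nat.cast_sub hck] at this
          linarith
      have h1 : (2 * k + 2 : ℚ) ≠ 0 := by positivity
      have h2 : (2 * k + 1 : ℚ) ≠ 0 := by positivity
      rw [eq_inv_mul_iff_mul_eq₀ (mul_ne_zero h1 h2), downNode_succ, upNode]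
      linear_combination (-(2 * k + 1 : ℚ)) * e1' + ((c : ℚ) + k + 1) * e2'

/-- The sum over all boxes of the binomial coefficients `(c + k - 1).choose (2 k)`. -/
def contentBinomialSum (k : ℕ) : Finset ℕ → ℚ :=
  contentSum fun c => ((c + k - 1).choose (2 * k) : ℚ)

theorem degreeLT_contentBinomialSum (k : ℕ) : DegreeLT (k + 2) (contentBinomialSum k) := by
  obtain ⟨q, hd, hq⟩ := exists_polynomial_choose k
  have h : contentBinomialSum k = contentSum fun c => q.eval (downNode c) := by
    funext S
    refine Finset.sum_congr rfl fun a _ => Finset.sum_congr rfl fun c hc => ?_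
    exact hq c (Finset.mem_Icc.1 hc).1
  rw [h]
  refine DegreeLT.contentSum_eval q (lt_of_le_of_lt (Polynomial.natDegree_le_iff_degree_le.1 hd) ?_)
  exact_mod_cast Nat.lt_succ_self k

theorem average_contentBinomialSum_of_le {k n : ℕ} (h : n ≤ k) :
    average (contentBinomialSum k) n = 0 := by
  refine Finset.sum_eq_zero fun S hS => ?_
  have hb := (Finset.mem_filter.1 hS).1
  rw [Finset.mem_powerset] at hb
  rw [contentBinomialSum, contentSum, Finset.sum_eq_zero, mul_zero]
  intro a ha
  refine Finset.sum_eq_zero fun c hc => ?_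
  have h1 := Finset.mem_Icc.1 (hb ha)
  have h2 := Finset.mem_Icc.1 hc
  rw [Nat.choose_eq_zero_of_lt (by omega), Nat.cast_zero]

theorem average_contentBinomialSum_succ (k : ℕ) :
    average (contentBinomialSum k) (k + 1) = 2 ^ k / (k + 1).factorial := by
  rw [average, Finset.sum_eq_single {k + 1}]
  · have hW : hookWeight {k + 1} = (k + 1).factorial := by
      simp [hookWeight, Finset.filter_singleton]
    have hS : contentBinomialSum k {k + 1} = 1 := by
      rw [contentBinomialSum, contentSum, Finset.sum_singleton, Finset.sum_eq_single (k + 1)]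
      · rw [show k + 1 + k - 1 = 2 * k by omega, Nat.choose_self, Nat.cast_one]
      · intro c hc hck
        have := Finset.mem_Icc.1 hc
        rw [Nat.choose_eq_zero_of_lt (by omega), Nat.cast_zero]
      · simp
    have hf : ((k + 1).factorial : ℚ) ≠ 0 := by exact_mod_cast (k + 1).factorial_ne_zero
    rw [plancherel, hW, hS, Finset.card_singleton, Nat.add_sub_cancel]
    field_simp
  · intro S hS hne
    rw [contentBinomialSum, contentSum, Finset.sum_eq_zero, mul_zero]
    intro a ha
    refine Finset.sum_eq_zero fun c hc => ?_
    have h2 := Finset.mem_Icc.1 hc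
    obtain ⟨h0, hs⟩ := mem_partSets.1 hS
    -- A part larger than `k` would use up the whole size `k + 1` and force the one-row shape.
    have hak : a ≤ k := by
      by_contra hlt
      have h3 := Finset.add_sum_erase S (fun b => b) ha
      have h4 : ∑ b ∈ S.erase a, b = 0 := by omega
      refine hne (Finset.eq_singleton_iff_unique_mem.2 ?_)
      have h5 : a = k + 1 := by omega
      refine ⟨h5 ▸ ha, fun b hb => ?_⟩
      by_contra hba
      have h6 := Finset.sum_eq_zero_iff.1 h4 b (Finset.mem_erase.2 ⟨h5 ▸ hba, hb⟩)
      exact h0 (h6 ▸ hb)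
    rw [Nat.choose_eq_zero_of_lt (by omega), Nat.cast_zero]
  · intro h
    exact absurd (mem_partSets.2 (by simp)) h

theorem average_contentBinomialSum (k n : ℕ) :
    average (contentBinomialSum k) n = 2 ^ k / (k + 1).factorial * n.choose (k + 1) := by
  rw [eq_choose_of_fwdDiff_eq_zero (DegreeLT.fwdDiff_average _ (degreeLT_contentBinomialSum k))
    (fun n hn => average_contentBinomialSum_of_le hn) n, average_contentBinomialSum_succ]

/-! ### Parts as a set, and the product formula for hook lengths -/

theorem part_pos (p : StrictPartition) {i : ℕ} (hi : 1 ≤ i) (h : i ≤ p.length) : 0 < p.part i := by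
  have hl : i - 1 < p.parts.length := by have : p.length = p.parts.length := rfl; omega
  rw [part, List.getD_eq_getElem _ _ hl]
  exact p.pos _ (List.getElem_mem hl)

theorem part_eq_zero (p : StrictPartition) {i : ℕ} (h : p.length < i) : p.part i = 0 := by
  rw [part, List.getD_eq_default]
  have : p.length = p.parts.length := rfl
  omega

theorem part_lt_part (p : StrictPartition) {i j : ℕ} (hi : 1 ≤ i) (hij : i < j)
    (hj : j ≤ p.length) : p.part j < p.part i := by
  have hl : p.length = p.parts.length := rfl
  rw [part, part, List.getD_eq_getElem _ _ (by omega), List.getD_eq_getElem _ _ (by omega)]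
  exact p.sorted.getElem_gt_getElem_of_lt (by omega)

/-- The set of parts. -/
def partSet (p : StrictPartition) : Finset ℕ := p.parts.toFinset

theorem image_part (p : StrictPartition) : (Finset.Icc 1 p.length).image p.part = p.partSet := by
  have hl : p.length = p.parts.length := rfl
  ext a
  simp only [Finset.mem_image, Finset.mem_Icc, partSet, List.mem_toFinset]
  constructor
  · rintro ⟨i, ⟨h1, h2⟩, rfl⟩
    rw [part, List.getD_eq_getElem _ _ (by omega)]
    exact List.getElem_mem _
  · intro h
    obtain ⟨i, hi, rfl⟩ := List.getElem_of_mem h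
    refine ⟨i + 1, by omega, ?_⟩
    rw [part, Nat.add_sub_cancel, List.getD_eq_getElem _ _ hi]

theorem part_injOn (p : StrictPartition) : Set.InjOn p.part (Finset.Icc 1 p.length) := by
  intro i hi j hj h
  simp only [Finset.coe_Icc, Set.mem_Icc] at hi hj
  rcases lt_trichotomy i j with h1 | h1 | h1
  · have := p.part_lt_part hi.1 h1 hj.2; omega
  · exact h1
  · have := p.part_lt_part hj.1 h1 hi.2; omega

theorem zero_notMem_partSet (p : StrictPartition) : 0 ∉ p.partSet := fun h =>
  lt_irrefl 0 (p.pos 0 (List.mem_toFinset.1 h))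

theorem card_partSet (p : StrictPartition) : p.partSet.card = p.length :=
  List.toFinset_card_of_nodup p.sorted.nodup

theorem sum_partSet (p : StrictPartition) : ∑ a ∈ p.partSet, a = p.size := by
  rw [partSet, List.sum_toFinset _ p.sorted.nodup, List.map_id', size]

theorem prod_partSet {M : Type*} [CommMonoid M] (p : StrictPartition) (f : ℕ → M) :
    ∏ a ∈ p.partSet, f a = ∏ i ∈ Finset.Icc 1 p.length, f (p.part i) := by
  rw [← image_part, Finset.prod_image p.part_injOn]

theorem prod_cells {M : Type*} [CommMonoid M] (p : StrictPartition) (f : ℕ × ℕ → M) :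
    ∏ b ∈ p.cells, f b = ∏ i ∈ Finset.Icc 1 p.length,
      ∏ j ∈ Finset.Icc (i + 1) (i + p.part i), f (i, j) := by
  rw [cells, Finset.prod_biUnion]
  · refine Finset.prod_congr rfl fun i _ => Finset.prod_image fun a _ b _ h => (Prod.mk.inj h).2
  · intro i _ j _ hij
    rw [Function.onFun, Finset.disjoint_left]
    intro x hx hx'
    obtain ⟨a, -, rfl⟩ := Finset.mem_image.1 hx
    obtain ⟨b, -, h⟩ := Finset.mem_image.1 hx'
    exact hij (Prod.mk.inj h).1.symm

/-- The number of boxes below a box in row `i` and column `j`. -/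
def leg (p : StrictPartition) (i j : ℕ) : ℕ :=
  ((Finset.Icc (i + 1) p.length).filter fun k => k < j ∧ j ≤ k + p.part k).card

theorem hookLength_eq (p : StrictPartition) {i j : ℕ} (hi : 1 ≤ i) (hi' : i ≤ p.length)
    (hj : i < j) (hj' : j ≤ i + p.part i) :
    p.hookLength (i, j) = (i + p.part i - j) + p.leg i j + 1 + p.part j := by
  have h1 : (p.cells.filter fun c => c.1 = i ∧ j < c.2) =
      (Finset.Icc (j + 1) (i + p.part i)).image fun k => (i, k) := by
    ext ⟨a, b⟩
    simp only [Finset.mem_filter, mem_cells, Finset.mem_image, Finset.mem_Icc, Prod.mk.injEq]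
    constructor
    · rintro ⟨⟨-, -, h⟩, rfl, h'⟩
      exact ⟨b, ⟨h', h⟩, rfl, rfl⟩
    · rintro ⟨k, ⟨h, h'⟩, rfl, rfl⟩
      exact ⟨⟨⟨hi, hi'⟩, by omega, h'⟩, rfl, h⟩
  have h2 : (p.cells.filter fun c => c.2 = j ∧ i < c.1) =
      ((Finset.Icc (i + 1) p.length).filter fun k => k < j ∧ j ≤ k + p.part k).image
        fun k => (k, j) := by
    ext ⟨a, b⟩
    simp only [Finset.mem_filter, mem_cells, Finset.mem_image, Finset.mem_Icc, Prod.mk.injEq]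
    constructor
    · rintro ⟨⟨h, h'⟩, rfl, h''⟩
      exact ⟨a, ⟨⟨h'', h.2⟩, h'⟩, rfl, rfl⟩
    · rintro ⟨k, ⟨⟨h, h'⟩, h''⟩, rfl, rfl⟩
      exact ⟨⟨⟨by omega, h'⟩, h''⟩, rfl, h⟩
  rw [hookLength, h1, h2, Finset.card_image_of_injective _ (fun a b h => (Prod.mk.inj h).2),
    Finset.card_image_of_injective _ (fun a b h => (Prod.mk.inj h).1), Nat.card_Icc, leg]
  congr 3
  omega

theorem add_part_le_add_part (p : StrictPartition) {i j : ℕ} (hi : 1 ≤ i) (hij : i ≤ j)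
    (hj : j ≤ p.length) : j + p.part j ≤ i + p.part i := by
  induction j, hij using Nat.le_induction with
  | base => exact le_rfl
  | succ j hij ih =>
    have := p.part_lt_part (by omega) (Nat.lt_add_one j) hj
    have := ih (by omega)
    omega

theorem length_lt_add_part (p : StrictPartition) {i : ℕ} (hi : 1 ≤ i) (h : i ≤ p.length) :
    p.length < i + p.part i := by
  have h1 := p.add_part_le_add_part hi h le_rfl
  have h2 := p.part_pos (hi.trans h) le_rfl
  omega

/-- Every row ends beyond column `p.length`, so the boxes below `(i, j)` are exactly one in each row
strictly between `i` and `j`. -/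
theorem hookLength_of_le_length (p : StrictPartition) {i j : ℕ} (hi : 1 ≤ i) (hj : i < j)
    (hj' : j ≤ p.length) : p.hookLength (i, j) = p.part i + p.part j := by
  have hlt := p.length_lt_add_part hi (hj.le.trans hj')
  have h : ((Finset.Icc (i + 1) p.length).filter fun k => k < j ∧ j ≤ k + p.part k) =
      Finset.Icc (i + 1) (j - 1) := by
    ext k
    simp only [Finset.mem_filter, Finset.mem_Icc]
    constructor
    · omega
    · rintro ⟨h1, h2⟩
      have := p.length_lt_add_part (i := k) (by omega) (by omega)
      omega
  rw [hookLength_eq p hi (by omega) hj (by omega), leg, h, Nat.card_Icc]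
  omega

/-- The hook lengths in row `i` beyond column `p.length`, and the differences of `p.part i` with
the later parts, are complementary in the interval from `1` to `p.part i`. -/
theorem prod_hookLength_mul_prod_sub (p : StrictPartition) {i : ℕ} (hi : 1 ≤ i)
    (hi' : i ≤ p.length) :
    (∏ j ∈ Finset.Icc (p.length + 1) (i + p.part i), p.hookLength (i, j)) *
      ∏ j ∈ Finset.Icc (i + 1) p.length, (p.part i - p.part j) = (p.part i).factorial := by
  have hlt := p.length_lt_add_part hi hi'
  have hval : ∀ j ∈ Finset.Icc (p.length + 1) (i + p.part i),
      p.hookLength (i, j) = (i + p.part i - j) + p.leg i j + 1 := by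
    intro j hj
    have hj := Finset.mem_Icc.1 hj
    rw [hookLength_eq p hi hi' (by omega) hj.2, p.part_eq_zero (i := j) (by omega), add_zero]
  have hanti : ∀ j j', j ≤ j' → p.length < j → p.leg i j' ≤ p.leg i j := by
    intro j j' h hj
    refine Finset.card_le_card fun k hk => ?_
    simp only [Finset.mem_filter, Finset.mem_Icc] at hk ⊢
    omega
  have hinj1 : Set.InjOn (fun j => p.hookLength (i, j))
      (Finset.Icc (p.length + 1) (i + p.part i)) := by
    have hlt' : ∀ j ∈ Finset.Icc (p.length + 1) (i + p.part i),
        ∀ j' ∈ Finset.Icc (p.length + 1) (i + p.part i), j < j' →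
          p.hookLength (i, j') < p.hookLength (i, j) := by
      intro j hj j' hj' h
      rw [hval j hj, hval j' hj']
      have h1 := Finset.mem_Icc.1 hj
      have h2 := Finset.mem_Icc.1 hj'
      have := hanti j j' h.le (by omega)
      omega
    intro j hj j' hj' h
    simp only at h
    rcases lt_trichotomy j j' with h1 | h1 | h1
    · have := hlt' j hj j' hj' h1; omega
    · exact h1
    · have := hlt' j' hj' j hj h1; omega
  have hinj2 : Set.InjOn (fun j => p.part i - p.part j) (Finset.Icc (i + 1) p.length) := by
    intro j hj j' hj' h
    have h1 := Finset.mem_Icc.1 hj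
    have h2 := Finset.mem_Icc.1 hj'
    have h3 := p.part_lt_part hi (show i < j by omega) h1.2
    have h4 := p.part_lt_part hi (show i < j' by omega) h2.2
    simp only at h
    exact p.part_injOn (Finset.mem_coe.2 (Finset.mem_Icc.2 ⟨by omega, h1.2⟩))
      (Finset.mem_coe.2 (Finset.mem_Icc.2 ⟨by omega, h2.2⟩)) (by omega)
  set A := (Finset.Icc (p.length + 1) (i + p.part i)).image fun j => p.hookLength (i, j) with hA
  set B := (Finset.Icc (i + 1) p.length).image fun j => p.part i - p.part j with hB
  have hdisj : Disjoint A B := by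
    rw [Finset.disjoint_left]
    intro x hx hx'
    obtain ⟨j, hj, rfl⟩ := Finset.mem_image.1 hx
    obtain ⟨k, hk, h⟩ := Finset.mem_image.1 hx'
    rw [hval j hj] at h
    have h1 := Finset.mem_Icc.1 hj
    have h2 := Finset.mem_Icc.1 hk
    have h3 := p.part_lt_part hi (show i < k by omega) h2.2
    -- A coincidence would force the leg to equal `j - i - 1 - p.part k`. If row `k` stops before
    -- column `j`, the leg is at most `k - 1 - i`, too small; otherwise it is at least `k - i`, too
    -- large.
    rcases Nat.lt_or_ge (k + p.part k) j with h4 | h4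
    · have : p.leg i j ≤ (Finset.Icc (i + 1) (k - 1)).card := by
        refine Finset.card_le_card fun l hl => ?_
        simp only [Finset.mem_filter, Finset.mem_Icc] at hl ⊢
        refine ⟨hl.1.1, ?_⟩
        by_contra hlk
        have := p.add_part_le_add_part (show 1 ≤ k by omega) (show k ≤ l by omega) hl.1.2
        omega
      rw [Nat.card_Icc] at this
      omega
    · have : (Finset.Icc (i + 1) k).card ≤ p.leg i j := by
        refine Finset.card_le_card fun l hl => ?_
        simp only [Finset.mem_filter, Finset.mem_Icc] at hl ⊢
        have := p.add_part_le_add_part (show 1 ≤ l by omega) hl.2 h2.2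
        omega
      rw [Nat.card_Icc] at this
      omega
  have hsub : A ∪ B ⊆ Finset.Icc 1 (p.part i) := by
    intro x hx
    rw [Finset.mem_Icc]
    rcases Finset.mem_union.1 hx with hx | hx
    · obtain ⟨j, hj, rfl⟩ := Finset.mem_image.1 hx
      rw [hval j hj]
      have h1 := Finset.mem_Icc.1 hj
      have : p.leg i j ≤ (Finset.Icc (i + 1) p.length).card := Finset.card_filter_le _ _
      rw [Nat.card_Icc] at this
      omega
    · obtain ⟨k, hk, rfl⟩ := Finset.mem_image.1 hx
      have h2 := Finset.mem_Icc.1 hk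
      have h3 := p.part_lt_part hi (show i < k by omega) h2.2
      omega
  -- The disjoint sets have `i + p.part i - p.length` and `p.length - i` elements, which add up to
  -- `p.part i`.
  have heq : A ∪ B = Finset.Icc 1 (p.part i) := by
    refine Finset.eq_of_subset_of_card_le hsub ?_
    rw [Finset.card_union_of_disjoint hdisj, hA, hB, Finset.card_image_of_injOn hinj1,
      Finset.card_image_of_injOn hinj2, Nat.card_Icc, Nat.card_Icc, Nat.card_Icc]
    omega
  have hfac : ∀ n : ℕ, ∏ x ∈ Finset.Icc 1 n, x = n.factorial := by
    intro n
    induction n with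
    | zero => rfl
    | succ n ih => rw [Finset.prod_Icc_succ_top (by omega), ih, Nat.factorial_succ, mul_comm]
  rw [← hfac, ← heq, Finset.prod_union hdisj, hA, hB,
    Finset.prod_image hinj1, Finset.prod_image hinj2]

theorem hookProduct_eq_hookWeight (p : StrictPartition) :
    (p.hookProduct : ℚ) = hookWeight p.partSet := by
  rw [hookProduct, prod_cells, hookWeight, prod_partSet, Nat.cast_prod]
  refine Finset.prod_congr rfl fun i hi => ?_
  obtain ⟨hi, hi'⟩ := Finset.mem_Icc.1 hi
  have hlt := p.length_lt_add_part hi hi'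
  have hfilter : (p.partSet.filter fun b => b < p.part i) =
      (Finset.Icc (i + 1) p.length).image p.part := by
    rw [← image_part]
    ext b
    simp only [Finset.mem_filter, Finset.mem_image, Finset.mem_Icc]
    constructor
    · rintro ⟨⟨j, hj, rfl⟩, h⟩
      refine ⟨j, ⟨?_, hj.2⟩, rfl⟩
      by_contra hji
      rcases Nat.lt_or_ge j i with h1 | h1
      · have := p.part_lt_part hj.1 h1 hi'; omega
      · obtain rfl : j = i := by omega
        omega
    · rintro ⟨j, hj, rfl⟩
      exact ⟨⟨j, ⟨by omega, hj.2⟩, rfl⟩, p.part_lt_part hi (by omega) hj.2⟩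
  have hinj : Set.InjOn p.part (Finset.Icc (i + 1) p.length) :=
    p.part_injOn.mono (by
      intro j hj
      simp only [Finset.coe_Icc, Set.mem_Icc] at hj ⊢
      omega)
  have hsplit : Finset.Icc (i + 1) (i + p.part i) =
      Finset.Icc (i + 1) p.length ∪ Finset.Icc (p.length + 1) (i + p.part i) := by
    ext j
    simp only [Finset.mem_union, Finset.mem_Icc]
    omega
  have hdisj : Disjoint (Finset.Icc (i + 1) p.length)
      (Finset.Icc (p.length + 1) (i + p.part i)) := by
    rw [Finset.disjoint_left]
    intro j hj hj'
    simp only [Finset.mem_Icc] at hj hj'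
    omega
  have h1 : ∏ j ∈ Finset.Icc (i + 1) p.length, p.hookLength (i, j) =
      ∏ j ∈ Finset.Icc (i + 1) p.length, (p.part i + p.part j) := by
    refine Finset.prod_congr rfl fun j hj => ?_
    have := Finset.mem_Icc.1 hj
    exact p.hookLength_of_le_length hi (by omega) this.2
  have h2 : ((∏ j ∈ Finset.Icc (i + 1) p.length, (p.part i - p.part j) : ℕ) : ℚ) =
      ∏ j ∈ Finset.Icc (i + 1) p.length, ((p.part i : ℚ) - p.part j) := by
    rw [Nat.cast_prod]
    refine Finset.prod_congr rfl fun j hj => ?_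
    have := Finset.mem_Icc.1 hj
    rw [Nat.cast_sub (p.part_lt_part hi (by omega) this.2).le]
  have h3 : ∏ j ∈ Finset.Icc (i + 1) p.length, ((p.part i : ℚ) - p.part j) ≠ 0 := by
    refine Finset.prod_ne_zero_iff.2 fun j hj => ?_
    have := Finset.mem_Icc.1 hj
    have h4 := p.part_lt_part hi (show i < j by omega) this.2
    have : (p.part j : ℚ) < p.part i := by exact_mod_cast h4
    exact (sub_pos.2 this).ne'
  rw [hfilter, Finset.prod_image hinj, hsplit, Finset.prod_union hdisj, h1,
    Finset.prod_div_distrib, ← mul_div_assoc, eq_div_iff h3, ← h2,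
    ← prod_hookLength_mul_prod_sub p hi hi']
  push_cast
  ring

/-! ### Tableaux as labelings, and the recursion on the largest label -/

/-- The box `b` lies to the right of `a` in the same row or below `a` in the same column. -/
def Precedes (a b : ℕ × ℕ) : Prop := (a.1 = b.1 ∧ a.2 < b.2) ∨ (a.2 = b.2 ∧ a.1 < b.1)

/-- The increasing labelings of a finite set of boxes by `0, …, n - 1`, as functions vanishing
outside of the set. -/
def labelings (C : Finset (ℕ × ℕ)) (n : ℕ) : Set (ℕ × ℕ → ℕ) :=
  {t | (∀ b ∉ C, t b = 0) ∧ Set.BijOn t C (Set.Iio n) ∧ ∀ a ∈ C, ∀ b ∈ C, Precedes a b → t a < t b}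

open Classical in
/-- The boxes that no other box of the set follows. -/
noncomputable def maximalBoxes (C : Finset (ℕ × ℕ)) : Finset (ℕ × ℕ) :=
  C.filter fun c => ∀ b ∈ C, ¬ Precedes c b

theorem mem_maximalBoxes {C : Finset (ℕ × ℕ)} {c : ℕ × ℕ} :
    c ∈ maximalBoxes C ↔ c ∈ C ∧ ∀ b ∈ C, ¬ Precedes c b := by
  simp [maximalBoxes]

theorem update_mem_labelings {C : Finset (ℕ × ℕ)} {n : ℕ} {c : ℕ × ℕ} (hc : c ∈ maximalBoxes C)
    {t : ℕ × ℕ → ℕ} (ht : t ∈ labelings (C.erase c) n) :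
    Function.update t c n ∈ labelings C (n + 1) := by
  obtain ⟨hcC, hmax⟩ := mem_maximalBoxes.1 hc
  obtain ⟨h0, hbij, hord⟩ := ht
  have hne : ∀ b ∈ C, b ≠ c → Function.update t c n b = t b ∧ t b < n := fun b hb hbc =>
    ⟨Function.update_of_ne hbc _ _,
      hbij.mapsTo (Finset.mem_coe.2 (Finset.mem_erase.2 ⟨hbc, hb⟩))⟩
  refine ⟨fun b hb => ?_, ⟨fun b hb => ?_, fun a ha b hb hab => ?_, fun v hv => ?_⟩,
    fun a ha b hb hab => ?_⟩
  · have hbc : b ≠ c := fun h => hb (h ▸ hcC)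
    rw [Function.update_of_ne hbc]
    exact h0 b fun h => hb (Finset.mem_of_mem_erase h)
  · by_cases hbc : b = c
    · simp [hbc]
    · obtain ⟨h1, h2⟩ := hne b hb hbc
      rw [Set.mem_Iio, h1]; omega
  · by_cases hac : a = c <;> by_cases hbc : b = c
    · rw [hac, hbc]
    · obtain ⟨h1, h2⟩ := hne b hb hbc
      rw [hac, Function.update_self, h1] at hab; omega
    · obtain ⟨h1, h2⟩ := hne a ha hac
      rw [hbc, Function.update_self, h1] at hab; omega
    · rw [(hne a ha hac).1, (hne b hb hbc).1] at hab
      exact hbij.injOn (Finset.mem_coe.2 (Finset.mem_erase.2 ⟨hac, ha⟩))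
        (Finset.mem_coe.2 (Finset.mem_erase.2 ⟨hbc, hb⟩)) hab
  · rcases Nat.lt_succ_iff_lt_or_eq.1 hv with h | rfl
    · obtain ⟨b, hb, rfl⟩ := hbij.surjOn h
      obtain ⟨hbc, hb⟩ := Finset.mem_erase.1 (Finset.mem_coe.1 hb)
      exact ⟨b, hb, (hne b hb hbc).1⟩
    · exact ⟨c, hcC, Function.update_self _ _ _⟩
  · have hac : a ≠ c := fun h => hmax b hb (h ▸ hab)
    rw [(hne a ha hac).1]
    by_cases hbc : b = c
    · rw [hbc, Function.update_self]
      exact (hne a ha hac).2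
    · rw [(hne b hb hbc).1]
      exact hord a (Finset.mem_erase.2 ⟨hac, ha⟩) b (Finset.mem_erase.2 ⟨hbc, hb⟩) hab

theorem exists_update_of_mem_labelings {C : Finset (ℕ × ℕ)} {n : ℕ} {t : ℕ × ℕ → ℕ}
    (ht : t ∈ labelings C (n + 1)) :
    ∃ c ∈ maximalBoxes C, ∃ u ∈ labelings (C.erase c) n, Function.update u c n = t := by
  obtain ⟨h0, hbij, hord⟩ := ht
  obtain ⟨c, hc, hcn⟩ := hbij.surjOn (show n ∈ Set.Iio (n + 1) from Nat.lt_succ_self n)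
  have hc : c ∈ C := hc
  refine ⟨c, mem_maximalBoxes.2 ⟨hc, fun b hb h => ?_⟩, Function.update t c 0, ⟨?_, ⟨?_, ?_, ?_⟩, ?_⟩,
    ?_⟩
  · have h1 := hord c hc b hb h
    have h2 : t b < n + 1 := hbij.mapsTo hb
    omega
  · intro b hb
    by_cases hbc : b = c
    · rw [hbc, Function.update_self]
    · rw [Function.update_of_ne hbc]
      exact h0 b fun h => hb (Finset.mem_erase.2 ⟨hbc, h⟩)
  · intro b hb
    obtain ⟨hbc, hb⟩ := Finset.mem_erase.1 (Finset.mem_coe.1 hb)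
    rw [Function.update_of_ne hbc]
    have h2 : t b < n + 1 := hbij.mapsTo hb
    have h3 : t b ≠ n := fun h => hbc (hbij.injOn hb hc (h.trans hcn.symm))
    exact lt_of_le_of_ne (Nat.lt_succ_iff.1 h2) h3
  · intro a ha b hb hab
    obtain ⟨hac, ha⟩ := Finset.mem_erase.1 (Finset.mem_coe.1 ha)
    obtain ⟨hbc, hb⟩ := Finset.mem_erase.1 (Finset.mem_coe.1 hb)
    rw [Function.update_of_ne hac, Function.update_of_ne hbc] at hab
    exact hbij.injOn ha hb hab
  · intro v hv
    have hv : v < n := hv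
    obtain ⟨b, hb, rfl⟩ := hbij.surjOn (show v ∈ Set.Iio (n + 1) from hv.trans (Nat.lt_succ_self n))
    have hbc : b ≠ c := by rintro rfl; omega
    exact ⟨b, Finset.mem_coe.2 (Finset.mem_erase.2 ⟨hbc, hb⟩), Function.update_of_ne hbc _ _⟩
  · intro a ha b hb hab
    obtain ⟨hac, ha⟩ := Finset.mem_erase.1 ha
    obtain ⟨hbc, hb⟩ := Finset.mem_erase.1 hb
    rw [Function.update_of_ne hac, Function.update_of_ne hbc]
    exact hord a ha b hb hab
  · rw [Function.update_idem, ← hcn, Function.update_eq_self]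

theorem labelings_succ (C : Finset (ℕ × ℕ)) (n : ℕ) :
    labelings C (n + 1) =
      ⋃ c ∈ maximalBoxes C, (fun t => Function.update t c n) '' labelings (C.erase c) n := by
  ext t
  simp only [Set.mem_iUnion, Set.mem_image, exists_prop]
  exact ⟨exists_update_of_mem_labelings, fun ⟨c, hc, u, hu, h⟩ => h ▸ update_mem_labelings hc hu⟩

theorem labelings_zero_subset (C : Finset (ℕ × ℕ)) : labelings C 0 ⊆ {0} := by
  rintro t ⟨h0, hbij, -⟩
  refine funext fun b => h0 b fun hb => ?_
  exact Nat.not_lt_zero _ (hbij.mapsTo hb)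

theorem finite_labelings (n : ℕ) : ∀ C : Finset (ℕ × ℕ), (labelings C n).Finite := by
  induction n with
  | zero => exact fun C => (Set.finite_singleton 0).subset (labelings_zero_subset C)
  | succ n ih =>
    intro C
    rw [labelings_succ]
    exact (maximalBoxes C).finite_toSet.biUnion fun c _ => (ih _).image _

/-- The box carrying the largest label is maximal and determines a unique piece of the
decomposition; deleting it leaves an arbitrary labeling of the other boxes. -/
theorem ncard_labelings_succ (C : Finset (ℕ × ℕ)) (n : ℕ) :
    (labelings C (n + 1)).ncard = ∑ c ∈ maximalBoxes C, (labelings (C.erase c) n).ncard := by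
  classical
  have hfin : ∀ c, ((fun t : ℕ × ℕ → ℕ => Function.update t c n) '' labelings (C.erase c) n).Finite :=
    fun c => (finite_labelings n _).image _
  have hU : labelings C (n + 1) = ((maximalBoxes C).biUnion fun c => (hfin c).toFinset : Finset _) := by
    rw [labelings_succ]
    ext t
    simp
  rw [hU, Set.ncard_coe_finset, Finset.card_biUnion]
  · refine Finset.sum_congr rfl fun c _ => ?_
    rw [← Set.ncard_eq_toFinset_card _ (hfin c), Set.InjOn.ncard_image]
    intro t ht u hu h
    funext b
    by_cases hbc : b = c
    · rw [hbc, ht.1 c (Finset.notMem_erase _ _), hu.1 c (Finset.notMem_erase _ _)]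
    · have := congrFun h b
      simpa only [Function.update_of_ne hbc] using this
  · intro c hc d hd hcd
    rw [Function.onFun, Finset.disjoint_left]
    intro t htc htd
    obtain ⟨u, hu, rfl⟩ := (Set.Finite.mem_toFinset _).1 htc
    obtain ⟨v, hv, h⟩ := (Set.Finite.mem_toFinset _).1 htd
    have h1 := congrFun h d
    simp only [Function.update_self, Function.update_of_ne (Ne.symm hcd)] at h1
    have h2 : u d < n := hu.2.1.mapsTo
      (Finset.mem_coe.2 (Finset.mem_erase.2 ⟨Ne.symm hcd, (mem_maximalBoxes.1 hd).1⟩))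
    omega

theorem numTableaux_eq_ncard (p : StrictPartition) :
    p.numTableaux = (labelings p.cells p.size).ncard := by
  classical
  let f : StandardTableau p → labelings p.cells p.size := fun T =>
    ⟨fun b => if h : b ∈ p.cells then (T.label ⟨b, h⟩ : ℕ) else 0, by
      refine ⟨fun b hb => dif_neg hb, ⟨fun b hb => ?_, fun a ha b hb hab => ?_, fun v hv => ?_⟩,
        fun a ha b hb hab => ?_⟩
      · simp only [dif_pos (Finset.mem_coe.1 hb)]
        exact (T.label _).2
      · simp only [dif_pos (Finset.mem_coe.1 ha), dif_pos (Finset.mem_coe.1 hb)] at hab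
        exact congrArg Subtype.val (T.label.injective (Fin.ext hab))
      · refine ⟨(T.label.symm ⟨v, hv⟩ : ℕ × ℕ), (T.label.symm ⟨v, hv⟩).2, ?_⟩
        simp
      · simp only [dif_pos ha, dif_pos hb]
        rcases hab with ⟨h1, h2⟩ | ⟨h1, h2⟩
        · exact T.row_lt ⟨a, ha⟩ ⟨b, hb⟩ h1 h2
        · exact T.col_lt ⟨a, ha⟩ ⟨b, hb⟩ h1 h2⟩
  refine Nat.card_congr (Equiv.ofBijective f ⟨fun T U h => ?_, fun t => ?_⟩)
  · refine StandardTableau.label_injective p (Equiv.ext fun b => Fin.ext ?_)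
    have := congrFun (congrArg Subtype.val h) b.1
    simpa only [f, dif_pos b.2] using this
  · obtain ⟨t, h0, hbij, hord⟩ := t
    let g : p.cells → Fin p.size := fun b => ⟨t b.1, hbij.mapsTo b.2⟩
    have hg : Function.Bijective g := by
      refine ⟨fun a b hab => Subtype.ext (hbij.injOn a.2 b.2 (congrArg Fin.val hab)), fun v => ?_⟩
      obtain ⟨b, hb, h⟩ := hbij.surjOn v.2
      exact ⟨⟨b, hb⟩, Fin.ext h⟩
    refine ⟨⟨Equiv.ofBijective g hg, fun a b h1 h2 => ?_, fun a b h1 h2 => ?_⟩, ?_⟩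
    · exact hord a.1 a.2 b.1 b.2 (Or.inl ⟨h1, h2⟩)
    · exact hord a.1 a.2 b.1 b.2 (Or.inr ⟨h1, h2⟩)
    · refine Subtype.ext (funext fun b => ?_)
      by_cases hb : b ∈ p.cells
      · simp only [f, dif_pos hb, Equiv.ofBijective_apply, g]
      · simp only [f, dif_neg hb, h0 b hb]

/-! ### Diagrams built from sets of parts, and the tableau count -/

/-- The number of elements of `S` that are at least `a`. -/
def rank (S : Finset ℕ) (a : ℕ) : ℕ := (S.filter fun b => a ≤ b).card

/-- The shifted diagram whose set of row lengths is `S`. -/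
def cellsOf (S : Finset ℕ) : Finset (ℕ × ℕ) :=
  S.biUnion fun a => (Finset.Icc (rank S a + 1) (rank S a + a)).image fun j => (rank S a, j)

theorem mem_cellsOf {S : Finset ℕ} {x : ℕ × ℕ} :
    x ∈ cellsOf S ↔ ∃ a ∈ S, x.1 = rank S a ∧ x.1 < x.2 ∧ x.2 ≤ x.1 + a := by
  obtain ⟨i, j⟩ := x
  simp only [cellsOf, Finset.mem_biUnion, Finset.mem_image, Finset.mem_Icc, Prod.mk.injEq]
  constructor
  · rintro ⟨a, ha, k, ⟨h1, h2⟩, rfl, rfl⟩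
    exact ⟨a, ha, rfl, h1, h2⟩
  · rintro ⟨a, ha, rfl, h1, h2⟩
    exact ⟨a, ha, j, ⟨h1, h2⟩, rfl, rfl⟩

theorem rank_part (p : StrictPartition) {i : ℕ} (hi : 1 ≤ i) (hi' : i ≤ p.length) :
    rank p.partSet (p.part i) = i := by
  have : (p.partSet.filter fun b => p.part i ≤ b) = (Finset.Icc 1 i).image p.part := by
    rw [← image_part]
    ext b
    simp only [Finset.mem_filter, Finset.mem_image, Finset.mem_Icc]
    constructor
    · rintro ⟨⟨j, hj, rfl⟩, h⟩
      refine ⟨j, ⟨hj.1, ?_⟩, rfl⟩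
      by_contra hji
      have := p.part_lt_part hi (show i < j by omega) hj.2
      omega
    · rintro ⟨j, hj, rfl⟩
      refine ⟨⟨j, ⟨hj.1, by omega⟩, rfl⟩, ?_⟩
      rcases Nat.lt_or_ge j i with h | h
      · exact (p.part_lt_part hj.1 h hi').le
      · rw [show j = i by omega]
  rw [rank, this, Finset.card_image_of_injOn, Nat.card_Icc, Nat.add_sub_cancel]
  refine p.part_injOn.mono fun j hj => ?_
  simp only [Finset.coe_Icc, Set.mem_Icc] at hj ⊢
  omega

theorem cells_eq_cellsOf (p : StrictPartition) : p.cells = cellsOf p.partSet := by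
  ext ⟨i, j⟩
  rw [mem_cells, mem_cellsOf]
  constructor
  · rintro ⟨⟨h1, h2⟩, h3⟩
    refine ⟨p.part i, ?_, (p.rank_part h1 h2).symm, h3⟩
    rw [← image_part]
    exact Finset.mem_image_of_mem _ (Finset.mem_Icc.2 ⟨h1, h2⟩)
  · rintro ⟨a, ha, h1, h2⟩
    rw [← image_part] at ha
    obtain ⟨k, hk, rfl⟩ := Finset.mem_image.1 ha
    obtain ⟨hk, hk'⟩ := Finset.mem_Icc.1 hk
    obtain rfl : i = k := h1.trans (p.rank_part hk hk')
    exact ⟨⟨hk, hk'⟩, h2⟩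

theorem rank_eq_add {S : Finset ℕ} {a b : ℕ} (h : b ≤ a) :
    rank S b = rank S a + (S.filter fun x => b ≤ x ∧ x < a).card := by
  rw [rank, rank, ← Finset.card_union_of_disjoint]
  · congr 1
    ext x
    simp only [Finset.mem_filter, Finset.mem_union]
    have : b ≤ x ↔ a ≤ x ∨ (b ≤ x ∧ x < a) := by omega
    tauto
  · rw [Finset.disjoint_left]
    intro x hx hx'
    simp only [Finset.mem_filter] at hx hx'
    omega

theorem rank_lt_rank {S : Finset ℕ} {a b : ℕ} (hb : b ∈ S) (h : b < a) : rank S a < rank S b := by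
  rw [rank_eq_add h.le]
  have : 0 < (S.filter fun x => b ≤ x ∧ x < a).card :=
    Finset.card_pos.2 ⟨b, Finset.mem_filter.2 ⟨hb, le_rfl, h⟩⟩
  omega

theorem rank_injOn (S : Finset ℕ) : Set.InjOn (rank S) S := by
  intro a ha b hb h
  rcases lt_trichotomy a b with h1 | h1 | h1
  · have := rank_lt_rank ha h1; omega
  · exact h1
  · have := rank_lt_rank hb h1; omega

/-- A maximal box ends its row, and the row of length `c` has nothing below its last box exactly
when no row has length `c - 1`. -/
theorem maximalBoxes_cellsOf {S : Finset ℕ} (hS : 0 ∉ S) :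
    maximalBoxes (cellsOf S) =
      (S.filter fun c => c - 1 ∉ S).image fun c => (rank S c, rank S c + c) := by
  ext ⟨i, j⟩
  rw [mem_maximalBoxes, mem_cellsOf]
  simp only [Finset.mem_image, Finset.mem_filter, Prod.mk.injEq]
  constructor
  · rintro ⟨⟨a, ha, rfl, h1, h2⟩, hmax⟩
    have hj : j = rank S a + a := by
      by_contra hne
      refine hmax (rank S a, j + 1) (mem_cellsOf.2 ⟨a, ha, rfl, ?_, ?_⟩) (Or.inl ⟨rfl, ?_⟩)
      all_goals simp only; omega
    refine ⟨a, ⟨ha, fun ha' => ?_⟩, rfl, hj.symm⟩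
    have ha1 : a - 1 ≠ 0 := fun h => hS (h ▸ ha')
    have hr : rank S (a - 1) = rank S a + 1 := by
      rw [rank_eq_add (Nat.sub_le a 1)]
      congr 1
      rw [Finset.card_eq_one]
      refine ⟨a - 1, ?_⟩
      ext x
      simp only [Finset.mem_filter, Finset.mem_singleton]
      constructor
      · omega
      · rintro rfl
        exact ⟨ha', by omega⟩
    refine hmax (rank S (a - 1), j) (mem_cellsOf.2 ⟨a - 1, ha', rfl, ?_, ?_⟩) (Or.inr ⟨rfl, ?_⟩)
    all_goals simp only; omega
  · rintro ⟨a, ⟨ha, ha'⟩, rfl, rfl⟩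
    have ha0 : a ≠ 0 := fun h => hS (h ▸ ha)
    refine ⟨⟨a, ha, rfl, by omega, le_rfl⟩, ?_⟩
    rintro ⟨i, j⟩ hij hp
    obtain ⟨b, hb, h1, h2, h3⟩ := mem_cellsOf.1 hij
    clear hij
    simp only at h1 h2 h3
    subst h1
    rcases hp with ⟨h4, h5⟩ | ⟨h4, h5⟩
    · simp only at h4 h5
      have := rank_injOn S ha hb h4
      subst this
      omega
    · simp only at h4 h5
      have hba : b < a := by
        by_contra h
        rcases (not_lt.1 h).eq_or_lt with rfl | h
        · omega
        · have := rank_lt_rank ha h; omega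
      have hr := rank_eq_add (S := S) hba.le
      -- As `a - 1` is not a part, row `b` lies at most `a - 1 - b` rows below row `a`, so it stops
      -- before the last column of row `a`.
      have hc : (S.filter fun x => b ≤ x ∧ x < a).card ≤ (Finset.Ico b (a - 1)).card := by
        refine Finset.card_le_card fun x hx => ?_
        simp only [Finset.mem_filter, Finset.mem_Ico] at hx ⊢
        have : x ≠ a - 1 := fun h => ha' (h ▸ hx.1)
        omega
      rw [Nat.card_Ico] at hc
      have hb1 : b ≠ a - 1 := fun h => ha' (h ▸ hb)
      omega

theorem rank_eq_sum (S : Finset ℕ) (a : ℕ) : rank S a = ∑ x ∈ S, if a ≤ x then 1 else 0 :=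
  Finset.card_filter _ _

/-- Shortening a row to a length not in use keeps the order of the rows, hence all row indices. -/
theorem cellsOf_erase {S : Finset ℕ} {d : ℕ} (hd : d + 1 ∈ S) (hd' : d ∉ S) :
    (cellsOf S).erase (rank S (d + 1), rank S (d + 1) + (d + 1)) =
      cellsOf (insert d (S.erase (d + 1))) := by
  have hdT : d ∉ S.erase (d + 1) := fun h => hd' (Finset.mem_of_mem_erase h)
  have hr1 : rank (insert d (S.erase (d + 1))) d = rank S (d + 1) := by
    rw [rank_eq_sum, rank_eq_sum, Finset.sum_insert hdT, ← Finset.add_sum_erase S _ hd,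
      if_pos le_rfl, if_pos le_rfl]
    congr 1
    refine Finset.sum_congr rfl fun x hx => ?_
    have : x ≠ d := fun h => hdT (h ▸ hx)
    exact if_congr (by omega) rfl rfl
  have hr2 : ∀ b, b ≠ d + 1 → rank (insert d (S.erase (d + 1))) b = rank S b := by
    intro b hb
    rw [rank_eq_sum, rank_eq_sum, Finset.sum_insert hdT, ← Finset.add_sum_erase S _ hd]
    congr 1
    exact if_congr (by omega) rfl rfl
  ext ⟨i, j⟩
  rw [Finset.mem_erase, mem_cellsOf, mem_cellsOf]
  simp only [Finset.mem_insert, Finset.mem_erase, ne_eq, Prod.mk.injEq]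
  constructor
  · rintro ⟨hne, a, ha, rfl, h1, h2⟩
    by_cases had : a = d + 1
    · subst had
      exact ⟨d, Or.inl rfl, hr1.symm, h1, by omega⟩
    · exact ⟨a, Or.inr ⟨had, ha⟩, (hr2 a had).symm, h1, h2⟩
  · rintro ⟨a, rfl | ⟨had, ha⟩, h0, h1, h2⟩
    · rw [hr1] at h0
      exact ⟨by omega, a + 1, hd, h0, h1, by omega⟩
    · rw [hr2 a had] at h0
      refine ⟨fun h => had (rank_injOn S ha hd (h0.symm.trans h.1)), a, ha, h0, h1, h2⟩

theorem cellsOf_erase_zero (S : Finset ℕ) : cellsOf (S.erase 0) = cellsOf S := by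
  have hr : ∀ a, a ≠ 0 → rank (S.erase 0) a = rank S a := by
    intro a ha
    rw [rank, rank, Finset.filter_erase, Finset.erase_eq_of_notMem]
    simp [ha]
  ext ⟨i, j⟩
  rw [mem_cellsOf, mem_cellsOf]
  simp only [Finset.mem_erase]
  constructor
  · rintro ⟨a, ⟨ha0, ha⟩, h0, h⟩
    exact ⟨a, ha, h0.trans (hr a ha0), h⟩
  · rintro ⟨a, ha, h0, h⟩
    have ha0 : a ≠ 0 := by omega
    exact ⟨a, ⟨ha0, ha⟩, h0.trans (hr a ha0).symm, h⟩

/-- Both sides satisfy the same recursion over removable boxes; on the right it is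
`sum_hookWeight_div`. -/
theorem ncard_labelings_cellsOf (n : ℕ) : ∀ S : Finset ℕ, 0 ∉ S → ∑ a ∈ S, a = n →
    ((labelings (cellsOf S) n).ncard : ℚ) = n.factorial / hookWeight S := by
  induction n with
  | zero =>
    intro S h0 hs
    have hS : S = ∅ := by
      refine Finset.eq_empty_of_forall_notMem fun a ha => h0 ?_
      exact (Finset.sum_eq_zero_iff.1 hs a ha) ▸ ha
    have h1 : labelings (cellsOf S) 0 = {0} := by
      refine (labelings_zero_subset _).antisymm ?_
      rintro _ rfl
      simp [hS, cellsOf, labelings]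
    rw [h1, Set.ncard_singleton, hS]
    simp [hookWeight]
  | succ n ih =>
    intro S h0 hs
    have hinj : Set.InjOn (fun c => (rank S c, rank S c + c)) (S.filter fun c => c - 1 ∉ S) :=
      fun a ha b hb h => rank_injOn S (Finset.mem_filter.1 ha).1 (Finset.mem_filter.1 hb).1
        (Prod.mk.inj h).1
    have hterm : ∀ c ∈ S.filter fun c => c - 1 ∉ S,
        ((labelings ((cellsOf S).erase (rank S c, rank S c + c)) n).ncard : ℚ) =
          n.factorial / hookWeight S * (hookWeight S / hookWeight (insert (c - 1) (S.erase c))) := by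
      intro c hc
      obtain ⟨hc, hc'⟩ := Finset.mem_filter.1 hc
      obtain ⟨d, rfl⟩ := Nat.exists_eq_succ_of_ne_zero (fun h => h0 (h ▸ hc) : c ≠ 0)
      simp only [Nat.succ_eq_add_one, Nat.add_sub_cancel] at *
      have hsum : ∑ a ∈ (insert d (S.erase (d + 1))).erase 0, a = n := by
        rw [Finset.sum_erase (f := fun a : ℕ => a) _ rfl,
          Finset.sum_insert fun h => hc' (Finset.mem_of_mem_erase h)]
        have := Finset.add_sum_erase S (fun a => a) hc
        omega
      rw [cellsOf_erase hc hc', ← cellsOf_erase_zero, ih _ (Finset.notMem_erase _ _) hsum,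
        hookWeight_erase_zero]
      have := (hookWeight_pos S).ne'
      field_simp
    rw [ncard_labelings_succ, maximalBoxes_cellsOf h0, Finset.sum_image hinj, Nat.cast_sum,
      Finset.sum_congr rfl hterm, ← Finset.mul_sum, sum_hookWeight_div S h0, hs,
      Nat.factorial_succ]
    push_cast
    ring

theorem numTableaux_eq (p : StrictPartition) :
    (p.numTableaux : ℚ) = p.size.factorial / hookWeight p.partSet := by
  rw [numTableaux_eq_ncard, cells_eq_cellsOf,
    ncard_labelings_cellsOf _ _ p.zero_notMem_partSet p.sum_partSet]

/-! ### Transfer from strict partitions to sets of parts -/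

theorem sum_cells_content (p : StrictPartition) (φ : ℕ → ℚ) :
    ∑ b ∈ p.cells, φ (content b) = contentSum φ p.partSet := by
  rw [contentSum, ← image_part, Finset.sum_image p.part_injOn]
  rw [cells, Finset.sum_biUnion]
  · refine Finset.sum_congr rfl fun i _ => ?_
    rw [Finset.sum_image fun a _ b _ h => (Prod.mk.inj h).2]
    refine Finset.sum_bij' (fun j _ => j - i) (fun c _ => i + c) ?_ ?_ ?_ ?_ ?_
    all_goals intro x hx
    all_goals simp only [Finset.mem_Icc, content] at hx ⊢
    all_goals omega
  · intro i _ j _ hij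
    rw [Function.onFun, Finset.disjoint_left]
    intro x hx hx'
    obtain ⟨a, -, rfl⟩ := Finset.mem_image.1 hx
    obtain ⟨b, -, h⟩ := Finset.mem_image.1 hx'
    exact hij (Prod.mk.inj h).1.symm

theorem partSet_injective : Function.Injective partSet := by
  intro p q h
  exact StrictPartition.ext ((List.perm_of_nodup_nodup_toFinset_eq p.sorted.nodup q.sorted.nodup
    h).eq_of_pairwise' p.sorted.pairwise q.sorted.pairwise)

theorem exists_partSet_eq {S : Finset ℕ} (hS : 0 ∉ S) : ∃ p : StrictPartition, p.partSet = S := by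
  refine ⟨⟨S.sort (· ≥ ·), ?_, fun x hx => ?_⟩, ?_⟩
  · exact S.sortedGT_sort
  · exact Nat.pos_of_ne_zero fun h => hS (h ▸ (Finset.mem_sort _).1 hx)
  · exact Finset.sort_toFinset _ _

theorem sum_ofSize (n : ℕ) (f : Finset ℕ → ℚ) :
    ∑ p ∈ ofSize n, f p.partSet = ∑ S ∈ partSets n, f S := by
  refine Finset.sum_bij (fun p _ => p.partSet) (fun p hp => ?_) (fun p _ q _ h => partSet_injective h)
    (fun S hS => ?_) fun _ _ => rfl
  · exact mem_partSets.2 ⟨p.zero_notMem_partSet, by rw [sum_partSet, (mem_ofSize n p).1 hp]⟩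
  · obtain ⟨h0, hs⟩ := mem_partSets.1 hS
    obtain ⟨p, rfl⟩ := exists_partSet_eq h0
    exact ⟨p, (mem_ofSize n p).2 (by rw [← sum_partSet, hs]), rfl⟩

end StrictPartition

theorem mainTheorem3 :
    (∀ k n : ℕ,
      ∑ p ∈ StrictPartition.ofSize n,
        (2 : ℚ) ^ (p.size - p.length) * (p.numTableaux : ℚ) / (p.hookProduct : ℚ) *
          ∑ b ∈ p.cells, ((StrictPartition.content b + k - 1).choose (2 * k) : ℚ) =
        (2 : ℚ) ^ k / ((k + 1).factorial : ℚ) * (n.choose (k + 1) : ℚ)) ∧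
    (∀ n : ℕ,
      ∑ p ∈ StrictPartition.ofSize n, 2 ^ (n - p.length) * p.numTableaux ^ 2 = n.factorial) := by
  constructor
  · intro k n
    rw [← StrictPartition.average_contentBinomialSum, StrictPartition.average,
      ← StrictPartition.sum_ofSize]
    refine Finset.sum_congr rfl fun p hp => ?_
    have hW := (StrictPartition.hookWeight_pos p.partSet).ne'
    rw [p.sum_cells_content fun c => ((c + k - 1).choose (2 * k) : ℚ),
      StrictPartition.contentBinomialSum, StrictPartition.plancherel, p.card_partSet,
      p.numTableaux_eq, p.hookProduct_eq_hookWeight, (StrictPartition.mem_ofSize n p).1 hp]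
    field_simp
  · intro n
    have h := StrictPartition.average_one n
    rw [StrictPartition.average, ← StrictPartition.sum_ofSize] at h
    have hf : (n.factorial : ℚ) ≠ 0 := by exact_mod_cast n.factorial_ne_zero
    have h' : ((∑ p ∈ StrictPartition.ofSize n, 2 ^ (n - p.length) * p.numTableaux ^ 2 : ℕ) : ℚ) =
        n.factorial := by
      rw [← mul_one (n.factorial : ℚ), ← h, Nat.cast_sum, Finset.mul_sum]
      refine Finset.sum_congr rfl fun p hp => ?_
      have hW := (StrictPartition.hookWeight_pos p.partSet).ne'
      push_cast
      rw [StrictPartition.plancherel, p.card_partSet, p.numTableaux_eq,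
        (StrictPartition.mem_ofSize n p).1 hp]
      field_simp
    exact_mod_cast h'
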